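/- **Conventions.** Categories are small (objects and hom-sets in one fixed universe); composition $f ⨾ g$ is written in diagrammatic order. For a category $V$, a profunctor $V(\bullet;\bullet\odot\bullet)$ is a family of sets $V(A;X\odot Y)$ with a functorial action $f\succ t\prec(g,h)$ of morphisms, contravariant in $A$ and covariant in $X,Y$; a profunctor $V(\bullet;J)$ is a presheaf of sets. Elements $(t\mid p)$ of a coend such as $\int^{U}V(A;U\odot Z)\times V(U;X\odot Y)$ are pairs modulo the equivalence relation generated by $(t\prec g\mid p)\sim(t\mid g\succ p)$. **Promonoidal categories.** A promonoidal structure $(\odot,J)$ on $V$ consists of profunctors $V(\bullet;\bullet\odot\bullet)$ and $V(\bullet;J)$ with isomorphisms, natural in all variables, $$\alpha:\textstyle\int^{U}V(A;U\odot Z)\times V(U;X\odot Y)\cong\int^{W}V(A;X\odot W)\times V(W;Y\odot Z),$$ $$\lambda:\textstyle\int^{U}V(A;U\odot X)\times V(U;J)\cong V(A;X),\qquad \rho:\int^{U}V(A;X\odot U)\times V(U;J)\cong V(A;X),$$ satisfying the pentagon and the triangle equations. **Produoidal categories.** A produoidal category is a category $V$ with two promonoidal structures, a parallel one $(\otimes,I)$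 and a sequential one $(\triangleleft,N)$, and natural transformations (laxators) $$\psi_2:V(A;(X\triangleleft Y)\otimes(Z\triangleleft W))\to V(A;(X\otimes Z)\triangleleft(Y\otimes W)),\quad \psi_0:V(A;I)\to V(A;I\triangleleft I),$$ $$\varphi_2:V(A;N\otimes N)\to V(A;N),\quad \varphi_0:V(A;I)\to V(A;N),$$ (nested expressions denote coends) satisfying the coherence equations of a duoidal category: $\psi_2$ is compatible with the associators of $\otimes$ and of $\triangleleft$; $\psi_2,\psi_0$ are compatible with the two unitors of $\otimes$; $\psi_2,\varphi_2$ are compatible with the two unitors of $\triangleleft$; $(\varphi_2,\varphi_0)$ is associative and unital; $(\psi_0,\varphi_0)$ is coassociative and counital. A produoidal functor is a functor together with natural transformations on the sets $V(A;X\otimes Y)$, $V(A;I)$, $V(A;X\triangleleft Y)$, $V(A;N)$ preserving both $\alpha,\lambda,\rho$ and all laxators. Produoidal categories and produoidal functors form a category $\mathbf{Produo}$. **Monoidal categories.** Let $\mathbf{Mon}$ be the category of (not necessarily strict) monoidal categories and strict monoidal functors, i.e. functors that preserve tensor, unit, associators and unitors on the nose. **Spliced monoidal arrows.** For a monoidal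 category $C$, the produoidal category $\mathcal T C$ has as objects the pairs $(A,B)$ of objects of $C$, written $\binom AB$, and - morphisms $\binom AB\to\binom XY$: pairs $f_0:A\to X$, $f_1:Y\to B$; - sequential splits $\mathcal TC(\binom AB;\binom XY\triangleleft\binom{X'}{Y'})$: triples $f_0:A\to X$, $f_1:Y\to X'$, $f_2:Y'\to B$; - parallel splits $\mathcal TC(\binom AB;\binom XY\otimes\binom{X'}{Y'})$: pairs $f_0:A\to X\otimes X'$, $f_1:Y\otimes Y'\to B$; - sequential units $\mathcal TC(\binom AB;N)=C(A;B)$; parallel units $\mathcal TC(\binom AB;I)=C(A;I)\times C(I;B)$; with actions by composition. Sequential associator: $\alpha(a\mid b)=(c\mid d)$ iff $a_0b_0=c_0$, $b_1=c_1d_0$, $b_2a_1=d_1$, $a_2=d_2c_2$. Sequential unitors: $\lambda(a\mid n)=(a_0na_1,\,a_2)$, $\rho(a\mid n)=(a_0,\,a_1na_2)$. Parallel associator (with $\alpha$ also denoting the associator of $C$): $\alpha(a\mid b)=(c\mid d)$ iff $a_0(b_0\otimes 1)\alpha=c_0(1\otimes d_0)$ and $\alpha^{-1}(b_1\otimes 1)a_1=(1\otimes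 d_1)c_1$. Parallel unitors: $\lambda(a\mid i)=(a_0(i_0\otimes1)\lambda,\ \lambda^{-1}(i_1\otimes1)a_1)$, $\rho(a\mid i)=(a_0(1\otimes i_0)\rho,\ \rho^{-1}(1\otimes i_1)a_1)$. Laxators: $\psi_2(a\mid b\mid c)=(d\mid e\mid f)$ iff $a_0(b_0\otimes c_0)=d_0e_0$, $b_1\otimes c_1=e_1d_1f_0$, $(b_2\otimes c_2)a_1=f_1d_2$; $\psi_0(a)=(b\mid c\mid d)$ iff $a_0=b_0c_0$, $1=c_1b_1d_0$, $a_1=d_1b_2$; $\varphi_2(a\mid n\mid m)=a_0(n\otimes m)a_1$; $\varphi_0(a)=a_0a_1$. A strict monoidal functor acts componentwise. This defines a functor $\mathcal T:\mathbf{Mon}\to\mathbf{Produo}$. **Monoidal contour.** For a produoidal category $B$, the monoidal category $\mathcal D B$ is freely presented by two generating objects $X^L,X^R$ for each object $X$ of $B$ and by the generating morphisms - $a_0:A^L\to X^L$, $a_1:X^R\to A^R$ for each $a\in B(A;X)$; - $a_0:A^L\to A^R$ for each $a\in B(A;N)$; - $a_0:A^L\to I$, $a_1:I\to A^R$ for each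 $a\in B(A;I)$; - $a_0:A^L\to X^L$, $a_1:X^R\to Y^L$, $a_2:Y^R\to A^R$ for each $a\in B(A;X\triangleleft Y)$; - $a_0:A^L\to X^L\otimes Y^L$, $a_1:X^R\otimes Y^R\to A^R$ for each $a\in B(A;X\otimes Y)$; subject to the following equations. - Functoriality: $(1_A)_0=1$, $(1_A)_1=1$, $(fg)_0=f_0g_0$, $(fg)_1=g_1f_1$; for the actions, $(f\succ n)_0=f_0n_0f_1$ for $n\in B(A;N)$; $(f\succ i)_0=f_0i_0$, $(f\succ i)_1=i_1f_1$ for $i\in B(A;I)$; $(f\succ s\prec(g,h))_0=f_0s_0g_0$, $(\dots)_1=g_1s_1h_0$, $(\dots)_2=h_1s_2f_1$ for sequential splits; $(f\succ t\prec(g,h))_0=f_0t_0(g_0\otimes h_0)$, $(\dots)_1=(g_1\otimes h_1)t_1f_1$ for parallel splits. - For $\triangleleft$: if $\alpha(a\mid b)=(c\mid d)$, then $a_0b_0=c_0$, $b_1=c_1d_0$, $b_2a_1=d_1$, $a_2=d_2c_2$; if $\lambda(a\mid n)=c$, then $c_0=a_0n_0a_1$, $c_1=a_2$; if $\rho(a\mid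 n)=c$, then $c_0=a_0$, $c_1=a_1n_0a_2$. - For $\otimes$: if $\alpha(a\mid b)=(c\mid d)$, then $a_0(b_0\otimes1)\alpha=c_0(1\otimes d_0)$ and $\alpha^{-1}(b_1\otimes1)a_1=(1\otimes d_1)c_1$; if $\lambda(a\mid i)=c$, then $c_0=a_0(i_0\otimes1)\lambda$, $c_1=\lambda^{-1}(i_1\otimes1)a_1$; if $\rho(a\mid i)=c$, then $c_0=a_0(1\otimes i_0)\rho$, $c_1=\rho^{-1}(1\otimes i_1)a_1$. - If $\psi_2(a\mid b\mid c)=(d\mid e\mid f)$, then $a_0(b_0\otimes c_0)=d_0e_0$, $b_1\otimes c_1=e_1d_1f_0$, $(b_2\otimes c_2)a_1=f_1d_2$. If $\psi_0(a)=(b\mid c\mid d)$, then $a_0=b_0c_0$, $1=c_1b_1d_0$, $a_1=d_1b_2$. If $\varphi_2(a\mid b\mid c)=d$, then $a_0(b_0\otimes c_0)a_1=d_0$. If $\varphi_0(a)=b$, then $a_0a_1=b_0$. A produoidal functor acts on generators. This defines a functor $\mathcal D:\mathbf{Produo}\to\mathbf{Mon}$. **Theorem.** The functor $\mathcal D:\mathbf{Produo}\to\mathbf{Mon}$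 is left adjoint to the functor $\mathcal T:\mathbf{Mon}\to\mathbf{Produo}$: there is an adjunction $\mathcal D\dashv\mathcal T$ between produoidal categories (with produoidal functors) and monoidal categories (with strict monoidal functors). -/

import Mathlib

open CategoryTheory MonoidalCategory

universe u

namespace Produo

/-! ## Profunctors and coends -/

/-- A profunctor `P : 1 ⧑ V`, given as a family of sets `P(A)` with a functorial action
`f ≻ p` of the morphisms of `V`; that is, a presheaf of sets. -/
structure UnitProf (V : Type u) [SmallCategory V] where
  obj : V → Type u
  act : ∀ {A' A : V}, (A' ⟶ A) → obj A → obj A'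
  act_id : ∀ {A : V} (p : obj A), act (𝟙 A) p = p
  act_comp : ∀ {A'' A' A : V} (f' : A'' ⟶ A') (f : A' ⟶ A) (p : obj A),
    act (f' ≫ f) p = act f' (act f p)

/-- A profunctor `T : V × V ⧑ V`, given as a family of sets `T(A; X, Y)` with a jointly
functorial action of the morphisms of `V`, contravariant in `A` and covariant in `X` and `Y`:
`act f t g h` is `f ≻ t ≺ (g, h)`. -/
structure SplitProf (V : Type u) [SmallCategory V] where
  obj : V → V → V → Type u
  act : ∀ {A' A X X' Y Y' : V}, (A' ⟶ A) → obj A X Y → (X ⟶ X') → (Y ⟶ Y') → obj A' X' Y'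
  act_id : ∀ {A X Y : V} (t : obj A X Y), act (𝟙 A) t (𝟙 X) (𝟙 Y) = t
  act_comp : ∀ {A'' A' A X X' X'' Y Y' Y'' : V} (f' : A'' ⟶ A') (f : A' ⟶ A) (t : obj A X Y)
    (g : X ⟶ X') (g' : X' ⟶ X'') (h : Y ⟶ Y') (h' : Y' ⟶ Y''),
    act (f' ≫ f) t (g ≫ g') (h ≫ h') = act f' (act f t g h) g' h'

namespace SplitProf

variable {V : Type u} [SmallCategory V] (T : SplitProf V)

/-- The presheaf `T(•; X, Y)`. -/
@[reducible]
def at₂ (X Y : V) : UnitProf V where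
  obj A := T.obj A X Y
  act f t := T.act f t (𝟙 X) (𝟙 Y)
  act_id t := T.act_id t
  act_comp f' f t := by rw [← T.act_comp, Category.id_comp, Category.id_comp]

/-- The generating relation of dinatural equivalence for `∫^U T(A; U, Z) × P(U)`. -/
inductive FillLRel (P : UnitProf V) (Z A : V) :
    (Σ U : V, T.obj A U Z × P.obj U) → (Σ U : V, T.obj A U Z × P.obj U) → Prop
  | dinat {U U' : V} (t : T.obj A U Z) (g : U ⟶ U') (p : P.obj U') :
      FillLRel P Z A ⟨U', T.act (𝟙 A) t g (𝟙 Z), p⟩ ⟨U, t, P.act g p⟩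

/-- The generating relation of dinatural equivalence for `∫^U T(A; X, U) × P(U)`. -/
inductive FillRRel (X : V) (P : UnitProf V) (A : V) :
    (Σ U : V, T.obj A X U × P.obj U) → (Σ U : V, T.obj A X U × P.obj U) → Prop
  | dinat {U U' : V} (t : T.obj A X U) (g : U ⟶ U') (p : P.obj U') :
      FillRRel X P A ⟨U', T.act (𝟙 A) t (𝟙 X) g, p⟩ ⟨U, t, P.act g p⟩

/-- The generating relation of dinatural equivalence for
`∫^{U, W} T(A; U, W) × P(U) × Q(W)`. -/
inductive ConvRel (P Q : UnitProf V) (A : V) :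
    (Σ (U W : V), T.obj A U W × P.obj U × Q.obj W) →
    (Σ (U W : V), T.obj A U W × P.obj U × Q.obj W) → Prop
  | dinat {U U' W W' : V} (t : T.obj A U W) (g : U ⟶ U') (h : W ⟶ W')
      (p : P.obj U') (q : Q.obj W') :
      ConvRel P Q A ⟨U', W', T.act (𝟙 A) t g h, p, q⟩ ⟨U, W, t, P.act g p, Q.act h q⟩

/-- The coend `∫^U T(•; U, Z) × P(U)`, that is, the composite `T(•; •₁, Z) ⋄ P(•₁)`. -/
def fillL (P : UnitProf V) (Z : V) : UnitProf V where
  obj A := Quot (T.FillLRel P Z A)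
  act {A' A} f := Quot.map (fun x => ⟨x.1, T.act f x.2.1 (𝟙 _) (𝟙 _), x.2.2⟩) (by
    rintro _ _ ⟨t, g, p⟩
    have h := FillLRel.dinat (T := T) (P := P) (T.act f t (𝟙 _) (𝟙 _)) g p
    rw [← T.act_comp] at h ⊢
    simpa using h)
  act_id := by rintro A ⟨⟨U, t, p⟩⟩; simp [Quot.map, T.act_id]
  act_comp := by
    rintro A'' A' A f' f ⟨⟨U, t, p⟩⟩
    simp [Quot.map, ← T.act_comp]

/-- The coend `∫^U T(•; X, U) × P(U)`, that is, the composite `T(•; X, •₁) ⋄ P(•₁)`. -/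
def fillR (X : V) (P : UnitProf V) : UnitProf V where
  obj A := Quot (T.FillRRel X P A)
  act {A' A} f := Quot.map (fun x => ⟨x.1, T.act f x.2.1 (𝟙 _) (𝟙 _), x.2.2⟩) (by
    rintro _ _ ⟨t, g, p⟩
    have h := FillRRel.dinat (T := T) (P := P) (T.act f t (𝟙 _) (𝟙 _)) g p
    rw [← T.act_comp] at h ⊢
    simpa using h)
  act_id := by rintro A ⟨⟨U, t, p⟩⟩; simp [Quot.map, T.act_id]
  act_comp := by
    rintro A'' A' A f' f ⟨⟨U, t, p⟩⟩
    simp [Quot.map, ← T.act_comp]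

/-- The coend `∫^{U, W} T(•; U, W) × P(U) × Q(W)`, that is, the composite
`T(•; •₁, •₂) ⋄ P(•₁) ⋄ Q(•₂)`. -/
def conv (P Q : UnitProf V) : UnitProf V where
  obj A := Quot (T.ConvRel P Q A)
  act {A' A} f := Quot.map
    (fun x => ⟨x.1, x.2.1, T.act f x.2.2.1 (𝟙 _) (𝟙 _), x.2.2.2.1, x.2.2.2.2⟩) (by
      rintro _ _ ⟨t, g, h, p, q⟩
      have e := ConvRel.dinat (T := T) (P := P) (Q := Q) (T.act f t (𝟙 _) (𝟙 _)) g h p q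
      rw [← T.act_comp] at e ⊢
      simpa using e)
  act_id := by rintro A ⟨⟨U, W, t, p, q⟩⟩; simp [Quot.map, T.act_id]
  act_comp := by
    rintro A'' A' A f' f ⟨⟨U, W, t, p, q⟩⟩
    simp [Quot.map, ← T.act_comp]

variable {T}

/-- The class `(t | p)` in `∫^U T(A; U, Z) × P(U)`. -/
def mkL {P : UnitProf V} {A U Z : V} (t : T.obj A U Z) (p : P.obj U) : (T.fillL P Z).obj A :=
  Quot.mk _ ⟨U, t, p⟩

/-- The class `(t | p)` in `∫^U T(A; X, U) × P(U)`. -/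
def mkR {P : UnitProf V} {A U X : V} (t : T.obj A X U) (p : P.obj U) : (T.fillR X P).obj A :=
  Quot.mk _ ⟨U, t, p⟩

/-- The class `(t | p | q)` in `∫^{U, W} T(A; U, W) × P(U) × Q(W)`. -/
def mk₂ {P Q : UnitProf V} {A U W : V} (t : T.obj A U W) (p : P.obj U) (q : Q.obj W) :
    (T.conv P Q).obj A :=
  Quot.mk _ ⟨U, W, t, p, q⟩

theorem mkL_dinat {P : UnitProf V} {A U U' Z : V} (t : T.obj A U Z) (g : U ⟶ U')
    (p : P.obj U') :
    (mkL (T.act (𝟙 A) t g (𝟙 Z)) p : (T.fillL P Z).obj A) = mkL t (P.act g p) :=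
  Quot.sound (.dinat t g p)

theorem mkR_dinat {P : UnitProf V} {A U U' X : V} (t : T.obj A X U) (g : U ⟶ U')
    (p : P.obj U') :
    (mkR (T.act (𝟙 A) t (𝟙 X) g) p : (T.fillR X P).obj A) = mkR t (P.act g p) :=
  Quot.sound (.dinat t g p)

theorem mk₂_dinat {P Q : UnitProf V} {A U U' W W' : V} (t : T.obj A U W) (g : U ⟶ U')
    (h : W ⟶ W') (p : P.obj U') (q : Q.obj W') :
    (mk₂ (T.act (𝟙 A) t g h) p q : (T.conv P Q).obj A) = mk₂ t (P.act g p) (Q.act h q) :=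
  Quot.sound (.dinat t g h p q)

end SplitProf

open SplitProf

/-! ## Promonoidal and produoidal categories -/

/-- A promonoidal structure on a category `V`. Writing `Y₀ ⊙ Y₁` for the virtual tensor and `J`
for the virtual unit, the isomorphisms are
`α : V(A; (X ⊙ Y) ⊙ Z) ≅ V(A; X ⊙ (Y ⊙ Z))`, `lam : V(A; J ⊙ X) ≅ V(A; X)` and
`rho : V(A; X ⊙ J) ≅ V(A; X)`. -/
structure Promonoidal (V : Type u) [SmallCategory V] where
  split : SplitProf V
  unit : UnitProf V
  assoc : ∀ A X Y Z : V,
    (split.fillL (split.at₂ X Y) Z).obj A ≃ (split.fillR X (split.at₂ Y Z)).obj A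
  lam : ∀ A X : V, (split.fillL unit X).obj A ≃ (A ⟶ X)
  rho : ∀ A X : V, (split.fillR X unit).obj A ≃ (A ⟶ X)
  /-- `α` is natural in all four variables -/
  assoc_natural : ∀ {A A' X X' Y Y' Z Z' U W : V} (f : A' ⟶ A) (g : X ⟶ X') (h : Y ⟶ Y')
    (k : Z ⟶ Z') (a : split.obj A U Z) (b : split.obj U X Y) (c : split.obj A X W)
    (d : split.obj W Y Z), assoc A X Y Z (mkL a b) = mkR c d →
    assoc A' X' Y' Z' (mkL (split.act f a (𝟙 U) k) (split.act (𝟙 U) b g h)) =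
      mkR (split.act f c g (𝟙 W)) (split.act (𝟙 W) d h k)
  lam_natural : ∀ {A A' X X' U : V} (f : A' ⟶ A) (g : X ⟶ X') (a : split.obj A U X)
    (n : unit.obj U), lam A' X' (mkL (split.act f a (𝟙 U) g) n) = f ≫ lam A X (mkL a n) ≫ g
  rho_natural : ∀ {A A' X X' U : V} (f : A' ⟶ A) (g : X ⟶ X') (a : split.obj A X U)
    (n : unit.obj U), rho A' X' (mkR (split.act f a g (𝟙 U)) n) = f ≫ rho A X (mkR a n) ≫ g
  /-- the two composites `V(A; ((X ⊙ Y) ⊙ Z) ⊙ W) → V(A; X ⊙ (Y ⊙ (Z ⊙ W)))` agree on every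
  element `(a | b | c)` -/
  pentagon : ∀ {A X Y Z W U U' : V} (a : split.obj A U W) (b : split.obj U U' Z)
    (c : split.obj U' X Y)
    -- the first composite `α ⨾ α`
    {P Q : V} (a₁ : split.obj A U' P) (b₁ : split.obj P Z W)
    (a₂ : split.obj A X Q) (c₂ : split.obj Q Y P)
    -- the second composite `(α ⋄ 1) ⨾ α ⨾ (1 ⋄ α)`
    {R S K : V} (b₃ : split.obj U X R) (c₃ : split.obj R Y Z)
    (a₄ : split.obj A X S) (b₄ : split.obj S R W)
    (b₅ : split.obj S Y K) (c₅ : split.obj K Z W),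
    assoc A U' Z W (mkL a b) = mkR a₁ b₁ →
    assoc A X Y P (mkL a₁ c) = mkR a₂ c₂ →
    assoc U X Y Z (mkL b c) = mkR b₃ c₃ →
    assoc A X R W (mkL a b₃) = mkR a₄ b₄ →
    assoc S Y Z W (mkL b₄ c₃) = mkR b₅ c₅ →
    (mkR a₂ (mkR c₂ b₁) : (split.fillR X (split.fillR Y (split.at₂ Z W))).obj A) =
      mkR a₄ (mkR b₅ c₅)
  /-- the two composites `V(A; (X ⊙ J) ⊙ Y) → V(A; X ⊙ Y)` agree on every element -/
  triangle : ∀ {A X Y U K W : V} (a : split.obj A U Y) (b : split.obj U X K) (n : unit.obj K)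
    (c : split.obj A X W) (d : split.obj W K Y), assoc A X K Y (mkL a b) = mkR c d →
    split.act (𝟙 A) a (rho U X (mkR b n)) (𝟙 Y) = split.act (𝟙 A) c (𝟙 X) (lam W Y (mkL d n))

/-- A produoidal structure on a category `V`: a parallel promonoidal structure `(⊗, I)` and a
sequential promonoidal structure `(◁, N)`, with natural laxators
`ψ₂ : V(A; (X ◁ Y) ⊗ (Z ◁ W)) → V(A; (X ⊗ Z) ◁ (Y ⊗ W))`, `ψ₀ : V(A; I) → V(A; I ◁ I)`,
`φ₂ : V(A; N ⊗ N) → V(A; N)` and `φ₀ : V(A; I) → V(A; N)`, subject to coherence. Each coherence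
diagram is stated on the elements of its source. -/
structure Produoidal (V : Type u) [SmallCategory V] where
  par : Promonoidal V
  seq : Promonoidal V
  psi₂ : ∀ A X Y Z W : V,
    (par.split.conv (seq.split.at₂ X Y) (seq.split.at₂ Z W)).obj A →
      (seq.split.conv (par.split.at₂ X Z) (par.split.at₂ Y W)).obj A
  psi₀ : ∀ A : V, par.unit.obj A → (seq.split.conv par.unit par.unit).obj A
  phi₂ : ∀ A : V, (par.split.conv seq.unit seq.unit).obj A → seq.unit.obj A
  phi₀ : ∀ A : V, par.unit.obj A → seq.unit.obj A
  psi₂_natural : ∀ {A A' X X' Y Y' Z Z' W W' U U' G H : V} (f : A' ⟶ A) (g : X ⟶ X')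
    (h : Y ⟶ Y') (k : Z ⟶ Z') (l : W ⟶ W')
    (a : par.split.obj A U U') (b : seq.split.obj U X Y) (c : seq.split.obj U' Z W)
    (d : seq.split.obj A G H) (e : par.split.obj G X Z) (e' : par.split.obj H Y W),
    psi₂ A X Y Z W (mk₂ a b c) = mk₂ d e e' →
    psi₂ A' X' Y' Z' W' (mk₂ (par.split.act f a (𝟙 U) (𝟙 U')) (seq.split.act (𝟙 U) b g h)
        (seq.split.act (𝟙 U') c k l)) =
      mk₂ (seq.split.act f d (𝟙 G) (𝟙 H)) (par.split.act (𝟙 G) e g k)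
        (par.split.act (𝟙 H) e' h l)
  psi₀_natural : ∀ {A A' : V} (f : A' ⟶ A) (i : par.unit.obj A),
    psi₀ A' (par.unit.act f i) = (seq.split.conv par.unit par.unit).act f (psi₀ A i)
  phi₂_natural : ∀ {A A' : V} (f : A' ⟶ A) (x : (par.split.conv seq.unit seq.unit).obj A),
    phi₂ A' ((par.split.conv seq.unit seq.unit).act f x) = seq.unit.act f (phi₂ A x)
  phi₀_natural : ∀ {A A' : V} (f : A' ⟶ A) (i : par.unit.obj A),
    phi₀ A' (par.unit.act f i) = seq.unit.act f (phi₀ A i)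
  /-- `((A ◁ B) ⊗ (C ◁ D)) ⊗ (E ◁ F) → (A ⊗ (C ⊗ E)) ◁ (B ⊗ (D ⊗ F))` -/
  psi₂_assoc_par : ∀ {X A B C D E F U U₁ U₂ U₃ : V}
    (t : par.split.obj X U U₃) (t' : par.split.obj U U₁ U₂)
    (s₁ : seq.split.obj U₁ A B) (s₂ : seq.split.obj U₂ C D) (s₃ : seq.split.obj U₃ E F)
    -- `(ψ₂ ⊗ 1) ⨾ ψ₂ ⨾ (α ◁ α)`
    {G H K L : V} (p : seq.split.obj U G H) (p₁ : par.split.obj G A C)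
    (p₂ : par.split.obj H B D)
    (q : seq.split.obj X K L) (q₁ : par.split.obj K G E) (q₂ : par.split.obj L H F)
    -- `α ⨾ (1 ⊗ ψ₂) ⨾ ψ₂`
    {M G' H' K' L' : V} (r : par.split.obj X U₁ M) (r' : par.split.obj M U₂ U₃)
    (v : seq.split.obj M G' H') (v₁ : par.split.obj G' C E) (v₂ : par.split.obj H' D F)
    (w : seq.split.obj X K' L') (w₁ : par.split.obj K' A G') (w₂ : par.split.obj L' B H'),
    psi₂ U A B C D (mk₂ t' s₁ s₂) = mk₂ p p₁ p₂ →
    psi₂ X G H E F (mk₂ t p s₃) = mk₂ q q₁ q₂ →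
    par.assoc X U₁ U₂ U₃ (mkL t t') = mkR r r' →
    psi₂ M C D E F (mk₂ r' s₂ s₃) = mk₂ v v₁ v₂ →
    psi₂ X A B G' H' (mk₂ r s₁ v) = mk₂ w w₁ w₂ →
    (mk₂ q (par.assoc K A C E (mkL q₁ p₁)) (par.assoc L B D F (mkL q₂ p₂)) :
      (seq.split.conv (par.split.fillR A (par.split.at₂ C E))
        (par.split.fillR B (par.split.at₂ D F))).obj X) =
      mk₂ w (mkR w₁ v₁) (mkR w₂ v₂)
  /-- `((A ◁ B) ◁ C) ⊗ ((D ◁ E) ◁ F) → (A ⊗ D) ◁ ((B ⊗ E) ◁ (C ⊗ F))` -/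
  psi₂_assoc_seq : ∀ {X A B C D E F U U₁ W W₁ : V} (t : par.split.obj X U W)
    (s : seq.split.obj U U₁ C) (s' : seq.split.obj U₁ A B)
    (z : seq.split.obj W W₁ F) (z' : seq.split.obj W₁ D E)
    -- `ψ₂ ⨾ (ψ₂ ◁ 1) ⨾ β`
    {G H G' H' K : V} (p : seq.split.obj X G H) (p₁ : par.split.obj G U₁ W₁)
    (p₂ : par.split.obj H C F)
    (q : seq.split.obj G G' H') (q₁ : par.split.obj G' A D) (q₂ : par.split.obj H' B E)
    (r : seq.split.obj X G' K) (r' : seq.split.obj K H' H)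
    -- `(β ⊗ β) ⨾ ψ₂ ⨾ (1 ◁ ψ₂)`
    {M M' G'' H'' L L' : V} (m : seq.split.obj U A M) (m' : seq.split.obj M B C)
    (o : seq.split.obj W D M') (o' : seq.split.obj M' E F)
    (v : seq.split.obj X G'' H'') (v₁ : par.split.obj G'' A D) (v₂ : par.split.obj H'' M M')
    (w : seq.split.obj H'' L L') (w₁ : par.split.obj L B E) (w₂ : par.split.obj L' C F),
    psi₂ X U₁ C W₁ F (mk₂ t s z) = mk₂ p p₁ p₂ →
    psi₂ G A B D E (mk₂ p₁ s' z') = mk₂ q q₁ q₂ →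
    seq.assoc X G' H' H (mkL p q) = mkR r r' →
    seq.assoc U A B C (mkL s s') = mkR m m' →
    seq.assoc W D E F (mkL z z') = mkR o o' →
    psi₂ X A M D M' (mk₂ t m o) = mk₂ v v₁ v₂ →
    psi₂ H'' B C E F (mk₂ v₂ m' o') = mk₂ w w₁ w₂ →
    (mk₂ r q₁ (mk₂ r' q₂ p₂) : (seq.split.conv (par.split.at₂ A D)
        (seq.split.conv (par.split.at₂ B E) (par.split.at₂ C F))).obj X) =
      mk₂ v v₁ (mk₂ w w₁ w₂)
  /-- `I ⊗ (A ◁ B) → A ◁ B` -/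
  psi₂_lam_par : ∀ {X A B U W : V} (t : par.split.obj X U W) (i : par.unit.obj U)
    (s : seq.split.obj W A B)
    {J J' G H : V} (p : seq.split.obj U J J') (j : par.unit.obj J) (j' : par.unit.obj J')
    (q : seq.split.obj X G H) (q₁ : par.split.obj G J A) (q₂ : par.split.obj H J' B),
    psi₀ U i = mk₂ p j j' →
    psi₂ X J J' A B (mk₂ t p s) = mk₂ q q₁ q₂ →
    seq.split.act (par.lam X W (mkL t i)) s (𝟙 A) (𝟙 B) =
      seq.split.act (𝟙 X) q (par.lam G A (mkL q₁ j)) (par.lam H B (mkL q₂ j'))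
  /-- `(A ◁ B) ⊗ I → A ◁ B` -/
  psi₂_rho_par : ∀ {X A B U W : V} (t : par.split.obj X W U) (s : seq.split.obj W A B)
    (i : par.unit.obj U)
    {J J' G H : V} (p : seq.split.obj U J J') (j : par.unit.obj J) (j' : par.unit.obj J')
    (q : seq.split.obj X G H) (q₁ : par.split.obj G A J) (q₂ : par.split.obj H B J'),
    psi₀ U i = mk₂ p j j' →
    psi₂ X A B J J' (mk₂ t s p) = mk₂ q q₁ q₂ →
    seq.split.act (par.rho X W (mkR t i)) s (𝟙 A) (𝟙 B) =
      seq.split.act (𝟙 X) q (par.rho G A (mkR q₁ j)) (par.rho H B (mkR q₂ j'))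
  /-- `(N ◁ A) ⊗ (N ◁ B) → A ⊗ B` -/
  psi₂_lam_seq : ∀ {X A B U W K K' : V} (t : par.split.obj X U W)
    (s : seq.split.obj U K A) (n : seq.unit.obj K) (s' : seq.split.obj W K' B)
    (n' : seq.unit.obj K')
    {G H : V} (q : seq.split.obj X G H) (q₁ : par.split.obj G K K') (q₂ : par.split.obj H A B),
    psi₂ X K A K' B (mk₂ t s s') = mk₂ q q₁ q₂ →
    par.split.act (seq.lam X H (mkL q (phi₂ G (mk₂ q₁ n n')))) q₂ (𝟙 A) (𝟙 B) =
      par.split.act (𝟙 X) t (seq.lam U A (mkL s n)) (seq.lam W B (mkL s' n'))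
  /-- `(A ◁ N) ⊗ (B ◁ N) → A ⊗ B` -/
  psi₂_rho_seq : ∀ {X A B U W K K' : V} (t : par.split.obj X U W)
    (s : seq.split.obj U A K) (n : seq.unit.obj K) (s' : seq.split.obj W B K')
    (n' : seq.unit.obj K')
    {G H : V} (q : seq.split.obj X G H) (q₁ : par.split.obj G A B) (q₂ : par.split.obj H K K'),
    psi₂ X A K B K' (mk₂ t s s') = mk₂ q q₁ q₂ →
    par.split.act (seq.rho X G (mkR q (phi₂ H (mk₂ q₂ n n')))) q₁ (𝟙 A) (𝟙 B) =
      par.split.act (𝟙 X) t (seq.rho U A (mkR s n)) (seq.rho W B (mkR s' n'))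
  /-- `(N ⊗ N) ⊗ N → N` -/
  phi₂_assoc : ∀ {X U K₁ K₂ K₃ M : V} (t : par.split.obj X U K₃) (t' : par.split.obj U K₁ K₂)
    (n₁ : seq.unit.obj K₁) (n₂ : seq.unit.obj K₂) (n₃ : seq.unit.obj K₃)
    (r : par.split.obj X K₁ M) (r' : par.split.obj M K₂ K₃),
    par.assoc X K₁ K₂ K₃ (mkL t t') = mkR r r' →
    phi₂ X (mk₂ t (phi₂ U (mk₂ t' n₁ n₂)) n₃) = phi₂ X (mk₂ r n₁ (phi₂ M (mk₂ r' n₂ n₃)))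
  /-- `I → I ◁ (I ◁ I)` -/
  psi₀_coassoc : ∀ {X U W : V} (i : par.unit.obj X) (s : seq.split.obj X U W)
    (i₁ : par.unit.obj U) (i₂ : par.unit.obj W)
    {P P' M Q Q' : V} (p : seq.split.obj U P P') (j : par.unit.obj P) (j' : par.unit.obj P')
    (r : seq.split.obj X P M) (r' : seq.split.obj M P' W)
    (q : seq.split.obj W Q Q') (k : par.unit.obj Q) (k' : par.unit.obj Q'),
    psi₀ X i = mk₂ s i₁ i₂ →
    psi₀ U i₁ = mk₂ p j j' →
    seq.assoc X P P' W (mkL s p) = mkR r r' →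
    psi₀ W i₂ = mk₂ q k k' →
    (mk₂ r j (mk₂ r' j' i₂) :
      (seq.split.conv par.unit (seq.split.conv par.unit par.unit)).obj X) =
      mk₂ s i₁ (mk₂ q k k')
  /-- `N ⊗ I → N` -/
  phi₂_phi₀_right : ∀ {X U W : V} (t : par.split.obj X U W) (n : seq.unit.obj U)
    (i : par.unit.obj W),
    phi₂ X (mk₂ t n (phi₀ W i)) = seq.unit.act (par.rho X U (mkR t i)) n
  /-- `I ⊗ N → N` -/
  phi₂_phi₀_left : ∀ {X U W : V} (t : par.split.obj X U W) (i : par.unit.obj U)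
    (n : seq.unit.obj W),
    phi₂ X (mk₂ t (phi₀ U i) n) = seq.unit.act (par.lam X W (mkL t i)) n
  /-- `I → I ◁ I → I ◁ N → I` -/
  psi₀_phi₀_right : ∀ {X U W : V} (i : par.unit.obj X) (s : seq.split.obj X U W)
    (i₁ : par.unit.obj U) (i₂ : par.unit.obj W), psi₀ X i = mk₂ s i₁ i₂ →
    par.unit.act (seq.rho X U (mkR s (phi₀ W i₂))) i₁ = i
  /-- `I → I ◁ I → N ◁ I → I` -/
  psi₀_phi₀_left : ∀ {X U W : V} (i : par.unit.obj X) (s : seq.split.obj X U W)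
    (i₁ : par.unit.obj U) (i₂ : par.unit.obj W), psi₀ X i = mk₂ s i₁ i₂ →
    par.unit.act (seq.lam X W (mkL s (phi₀ U i₁))) i₂ = i

/-- A (small) produoidal category. -/
structure PDuo : Type (u + 1) where
  carrier : Type u
  [cat : SmallCategory carrier]
  str : Produoidal carrier

attribute [instance] PDuo.cat

namespace PDuo

variable (B : PDuo.{u})

/-- parallel splits `B(A; X ⊗ Y)` -/
abbrev ParSplit (A X Y : B.carrier) : Type u := B.str.par.split.obj A X Y
/-- parallel units `B(A; I)` -/
abbrev ParUnit (A : B.carrier) : Type u := B.str.par.unit.obj A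
/-- sequential splits `B(A; X ◁ Y)` -/
abbrev SeqSplit (A X Y : B.carrier) : Type u := B.str.seq.split.obj A X Y
/-- sequential units `B(A; N)` -/
abbrev SeqUnit (A : B.carrier) : Type u := B.str.seq.unit.obj A

end PDuo

/-- A produoidal functor: a functor with natural transformations on splits and units, preserving
the coherence isomorphisms of both promonoidal structures and the laxators. -/
@[ext]
structure PDuoFunctor (B C : PDuo.{u}) where
  fn : B.carrier ⥤ C.carrier
  mapPar : ∀ {A X Y : B.carrier}, B.ParSplit A X Y → C.ParSplit (fn.obj A) (fn.obj X) (fn.obj Y)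
  mapParUnit : ∀ {A : B.carrier}, B.ParUnit A → C.ParUnit (fn.obj A)
  mapSeq : ∀ {A X Y : B.carrier}, B.SeqSplit A X Y → C.SeqSplit (fn.obj A) (fn.obj X) (fn.obj Y)
  mapSeqUnit : ∀ {A : B.carrier}, B.SeqUnit A → C.SeqUnit (fn.obj A)
  mapPar_natural : ∀ {A A' X X' Y Y' : B.carrier} (f : A' ⟶ A) (t : B.ParSplit A X Y)
    (g : X ⟶ X') (h : Y ⟶ Y'), mapPar (B.str.par.split.act f t g h) =
      C.str.par.split.act (fn.map f) (mapPar t) (fn.map g) (fn.map h)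
  mapParUnit_natural : ∀ {A A' : B.carrier} (f : A' ⟶ A) (i : B.ParUnit A),
    mapParUnit (B.str.par.unit.act f i) = C.str.par.unit.act (fn.map f) (mapParUnit i)
  mapSeq_natural : ∀ {A A' X X' Y Y' : B.carrier} (f : A' ⟶ A) (s : B.SeqSplit A X Y)
    (g : X ⟶ X') (h : Y ⟶ Y'), mapSeq (B.str.seq.split.act f s g h) =
      C.str.seq.split.act (fn.map f) (mapSeq s) (fn.map g) (fn.map h)
  mapSeqUnit_natural : ∀ {A A' : B.carrier} (f : A' ⟶ A) (n : B.SeqUnit A),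
    mapSeqUnit (B.str.seq.unit.act f n) = C.str.seq.unit.act (fn.map f) (mapSeqUnit n)
  par_assoc : ∀ {A X Y Z U W : B.carrier} (a : B.ParSplit A U Z) (b : B.ParSplit U X Y)
    (c : B.ParSplit A X W) (d : B.ParSplit W Y Z),
    B.str.par.assoc A X Y Z (mkL a b) = mkR c d →
    C.str.par.assoc _ _ _ _ (mkL (mapPar a) (mapPar b)) = mkR (mapPar c) (mapPar d)
  par_lam : ∀ {A X U : B.carrier} (a : B.ParSplit A U X) (i : B.ParUnit U),
    fn.map (B.str.par.lam A X (mkL a i)) =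
      C.str.par.lam _ _ (mkL (mapPar a) (mapParUnit i))
  par_rho : ∀ {A X U : B.carrier} (a : B.ParSplit A X U) (i : B.ParUnit U),
    fn.map (B.str.par.rho A X (mkR a i)) =
      C.str.par.rho _ _ (mkR (mapPar a) (mapParUnit i))
  seq_assoc : ∀ {A X Y Z U W : B.carrier} (a : B.SeqSplit A U Z) (b : B.SeqSplit U X Y)
    (c : B.SeqSplit A X W) (d : B.SeqSplit W Y Z),
    B.str.seq.assoc A X Y Z (mkL a b) = mkR c d →
    C.str.seq.assoc _ _ _ _ (mkL (mapSeq a) (mapSeq b)) = mkR (mapSeq c) (mapSeq d)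
  seq_lam : ∀ {A X U : B.carrier} (a : B.SeqSplit A U X) (n : B.SeqUnit U),
    fn.map (B.str.seq.lam A X (mkL a n)) =
      C.str.seq.lam _ _ (mkL (mapSeq a) (mapSeqUnit n))
  seq_rho : ∀ {A X U : B.carrier} (a : B.SeqSplit A X U) (n : B.SeqUnit U),
    fn.map (B.str.seq.rho A X (mkR a n)) =
      C.str.seq.rho _ _ (mkR (mapSeq a) (mapSeqUnit n))
  psi₂ : ∀ {A X Y Z W U U' G H : B.carrier} (a : B.ParSplit A U U') (b : B.SeqSplit U X Y)
    (c : B.SeqSplit U' Z W) (d : B.SeqSplit A G H) (e : B.ParSplit G X Z)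
    (e' : B.ParSplit H Y W), B.str.psi₂ A X Y Z W (mk₂ a b c) = mk₂ d e e' →
    C.str.psi₂ _ _ _ _ _ (mk₂ (mapPar a) (mapSeq b) (mapSeq c)) =
      mk₂ (mapSeq d) (mapPar e) (mapPar e')
  psi₀ : ∀ {A G H : B.carrier} (i : B.ParUnit A) (s : B.SeqSplit A G H) (j : B.ParUnit G)
    (k : B.ParUnit H), B.str.psi₀ A i = mk₂ s j k →
    C.str.psi₀ _ (mapParUnit i) = mk₂ (mapSeq s) (mapParUnit j) (mapParUnit k)
  phi₂ : ∀ {A U W : B.carrier} (t : B.ParSplit A U W) (n : B.SeqUnit U) (m : B.SeqUnit W),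
    mapSeqUnit (B.str.phi₂ A (mk₂ t n m)) =
      C.str.phi₂ _ (mk₂ (mapPar t) (mapSeqUnit n) (mapSeqUnit m))
  phi₀ : ∀ {A : B.carrier} (i : B.ParUnit A),
    mapSeqUnit (B.str.phi₀ A i) = C.str.phi₀ _ (mapParUnit i)

/-- The identity produoidal functor. -/
def PDuoFunctor.id (B : PDuo.{u}) : PDuoFunctor B B where
  fn := 𝟭 _
  mapPar t := t
  mapParUnit i := i
  mapSeq s := s
  mapSeqUnit n := n
  mapPar_natural _ _ _ _ := rfl
  mapParUnit_natural _ _ := rfl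
  mapSeq_natural _ _ _ _ := rfl
  mapSeqUnit_natural _ _ := rfl
  par_assoc _ _ _ _ h := h
  par_lam _ _ := rfl
  par_rho _ _ := rfl
  seq_assoc _ _ _ _ h := h
  seq_lam _ _ := rfl
  seq_rho _ _ := rfl
  psi₂ _ _ _ _ _ _ h := h
  psi₀ _ _ _ _ h := h
  phi₂ _ _ _ := rfl
  phi₀ _ := rfl

/-- Composition of produoidal functors. -/
def PDuoFunctor.comp {B C D : PDuo.{u}} (F : PDuoFunctor B C) (G : PDuoFunctor C D) :
    PDuoFunctor B D where
  fn := F.fn ⋙ G.fn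
  mapPar t := G.mapPar (F.mapPar t)
  mapParUnit i := G.mapParUnit (F.mapParUnit i)
  mapSeq s := G.mapSeq (F.mapSeq s)
  mapSeqUnit n := G.mapSeqUnit (F.mapSeqUnit n)
  mapPar_natural _ _ _ _ := by rw [F.mapPar_natural, G.mapPar_natural]; rfl
  mapParUnit_natural _ _ := by rw [F.mapParUnit_natural, G.mapParUnit_natural]; rfl
  mapSeq_natural _ _ _ _ := by rw [F.mapSeq_natural, G.mapSeq_natural]; rfl
  mapSeqUnit_natural _ _ := by rw [F.mapSeqUnit_natural, G.mapSeqUnit_natural]; rfl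
  par_assoc _ _ _ _ h := G.par_assoc _ _ _ _ (F.par_assoc _ _ _ _ h)
  par_lam _ _ := by rw [Functor.comp_map, F.par_lam, G.par_lam]; rfl
  par_rho _ _ := by rw [Functor.comp_map, F.par_rho, G.par_rho]; rfl
  seq_assoc _ _ _ _ h := G.seq_assoc _ _ _ _ (F.seq_assoc _ _ _ _ h)
  seq_lam _ _ := by rw [Functor.comp_map, F.seq_lam, G.seq_lam]; rfl
  seq_rho _ _ := by rw [Functor.comp_map, F.seq_rho, G.seq_rho]; rfl
  psi₂ _ _ _ _ _ _ h := G.psi₂ _ _ _ _ _ _ (F.psi₂ _ _ _ _ _ _ h)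
  psi₀ _ _ _ _ h := G.psi₀ _ _ _ _ (F.psi₀ _ _ _ _ h)
  phi₂ _ _ _ := by rw [F.phi₂, G.phi₂]; rfl
  phi₀ _ := by rw [F.phi₀, G.phi₀]; rfl

/-- The category of produoidal categories and produoidal functors. -/
instance : LargeCategory PDuo.{u} where
  Hom B C := PDuoFunctor B C
  id B := PDuoFunctor.id B
  comp F G := F.comp G

/-- A (small) monoidal category. -/
structure MonoCat : Type (u + 1) where
  carrier : Type u
  [cat : SmallCategory carrier]
  [mon : MonoidalCategory carrier]

attribute [instance] MonoCat.cat MonoCat.mon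

/-- A strict monoidal functor between (not necessarily strict) monoidal categories: a functor
that preserves the unit, the tensor, the associators and the unitors on the nose. -/
@[ext]
structure StrictMonoidalFunctor (C D : MonoCat.{u}) where
  fn : C.carrier ⥤ D.carrier
  obj_unit : fn.obj (𝟙_ C.carrier) = 𝟙_ D.carrier
  obj_tensor : ∀ X Y : C.carrier, fn.obj (X ⊗ Y) = fn.obj X ⊗ fn.obj Y
  map_tensor : ∀ {X Y X' Y' : C.carrier} (f : X ⟶ Y) (g : X' ⟶ Y'),
    fn.map (f ⊗ₘ g) = eqToHom (obj_tensor X X') ≫ (fn.map f ⊗ₘ fn.map g) ≫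
      eqToHom (obj_tensor Y Y').symm
  map_associator : ∀ X Y Z : C.carrier,
    fn.map (α_ X Y Z).hom = eqToHom (by rw [obj_tensor, obj_tensor]) ≫
      (α_ (fn.obj X) (fn.obj Y) (fn.obj Z)).hom ≫ eqToHom (by rw [obj_tensor, obj_tensor])
  map_leftUnitor : ∀ X : C.carrier,
    fn.map (λ_ X).hom = eqToHom (by rw [obj_tensor, obj_unit]) ≫ (λ_ (fn.obj X)).hom
  map_rightUnitor : ∀ X : C.carrier,
    fn.map (ρ_ X).hom = eqToHom (by rw [obj_tensor, obj_unit]) ≫ (ρ_ (fn.obj X)).hom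

/-- The identity strict monoidal functor. -/
def StrictMonoidalFunctor.id (C : MonoCat.{u}) : StrictMonoidalFunctor C C where
  fn := 𝟭 _
  obj_unit := rfl
  obj_tensor _ _ := rfl
  map_tensor _ _ := by simp
  map_associator _ _ _ := by simp
  map_leftUnitor _ := by simp
  map_rightUnitor _ := by simp

/-- Composition of strict monoidal functors. -/
def StrictMonoidalFunctor.comp {C D E : MonoCat.{u}} (F : StrictMonoidalFunctor C D)
    (G : StrictMonoidalFunctor D E) : StrictMonoidalFunctor C E where
  fn := F.fn ⋙ G.fn
  obj_unit := by rw [Functor.comp_obj, F.obj_unit, G.obj_unit]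
  obj_tensor _ _ := by rw [Functor.comp_obj, F.obj_tensor, G.obj_tensor]; rfl
  map_tensor _ _ := by simp [F.map_tensor, G.map_tensor, eqToHom_map]
  map_associator _ _ _ := by simp [F.map_associator, G.map_associator, eqToHom_map]
  map_leftUnitor _ := by simp [F.map_leftUnitor, G.map_leftUnitor, eqToHom_map]
  map_rightUnitor _ := by simp [F.map_rightUnitor, G.map_rightUnitor, eqToHom_map]

/-- The category of monoidal categories and strict monoidal functors. -/
instance : LargeCategory MonoCat.{u} where
  Hom C D := StrictMonoidalFunctor C D
  id C := StrictMonoidalFunctor.id C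
  comp F G := F.comp G

/-! ## Spliced monoidal arrows -/

namespace Splice

/-- Objects of the splice: pairs of objects. -/
@[ext]
structure Obj (C : Type u) where
  l : C
  r : C

variable {C : Type u} [SmallCategory C]

/-- Morphisms `f₀ ⨾ □ ⨾ f₁`. -/
@[ext]
structure Hom (A X : Obj C) where
  f₀ : A.l ⟶ X.l
  f₁ : X.r ⟶ A.r

instance : SmallCategory (Obj C) where
  Hom A X := Hom A X
  id A := ⟨𝟙 A.l, 𝟙 A.r⟩
  comp f g := ⟨f.f₀ ≫ g.f₀, g.f₁ ≫ f.f₁⟩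
  id_comp f := by ext <;> simp
  comp_id f := by ext <;> simp
  assoc f g h := by ext <;> simp

@[ext] theorem hom_ext {A X : Obj C} {f g : A ⟶ X} (h₀ : f.f₀ = g.f₀) (h₁ : f.f₁ = g.f₁) :
    f = g := Hom.ext h₀ h₁
@[simp] theorem id_f₀ (A : Obj C) : Hom.f₀ (𝟙 A) = 𝟙 A.l := rfl
@[simp] theorem id_f₁ (A : Obj C) : Hom.f₁ (𝟙 A) = 𝟙 A.r := rfl
@[simp] theorem comp_f₀ {A X Y : Obj C} (f : A ⟶ X) (g : X ⟶ Y) :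
    Hom.f₀ (f ≫ g) = f.f₀ ≫ g.f₀ := rfl
@[simp] theorem comp_f₁ {A X Y : Obj C} (f : A ⟶ X) (g : X ⟶ Y) :
    Hom.f₁ (f ≫ g) = g.f₁ ≫ f.f₁ := rfl

/-- Sequential splits `f₀ ⨾ □ ⨾ f₁ ⨾ □ ⨾ f₂`. -/
@[ext]
structure SeqSplit (A X Y : Obj C) where
  f₀ : A.l ⟶ X.l
  f₁ : X.r ⟶ Y.l
  f₂ : Y.r ⟶ A.r

/-- The profunctor of sequential splits. -/
@[reducible]
def seqSplit (C : Type u) [SmallCategory C] : SplitProf (Obj C) where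
  obj A X Y := SeqSplit A X Y
  act f t g h := ⟨f.f₀ ≫ t.f₀ ≫ g.f₀, g.f₁ ≫ t.f₁ ≫ h.f₀, h.f₁ ≫ t.f₂ ≫ f.f₁⟩
  act_id t := by ext <;> simp
  act_comp f' f t g g' h h' := by ext <;> simp

/-- The profunctor of sequential units: arrows `f : A → B`. -/
@[reducible]
def seqUnit (C : Type u) [SmallCategory C] : UnitProf (Obj C) where
  obj A := A.l ⟶ A.r
  act f n := f.f₀ ≫ n ≫ f.f₁
  act_id n := by simp
  act_comp f' f n := by simp

/-- Four composable arrows with three gaps between them: `V(A; X ◁ Y ◁ Z)`. -/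
@[ext]
structure Quad (A X Y Z : Obj C) where
  f₀ : A.l ⟶ X.l
  f₁ : X.r ⟶ Y.l
  f₂ : Y.r ⟶ Z.l
  f₃ : Z.r ⟶ A.r

/-- `(a | b) ↦ a₀ ⨾ b₀ ⨾ □ ⨾ b₁ ⨾ □ ⨾ b₂ ⨾ a₁ ⨾ □ ⨾ a₂` -/
def seqQuadL (A X Y Z : Obj C) :
    ((seqSplit C).fillL ((seqSplit C).at₂ X Y) Z).obj A ≃ Quad A X Y Z where
  toFun := Quot.lift (fun x => ⟨x.2.1.f₀ ≫ x.2.2.f₀, x.2.2.f₁, x.2.2.f₂ ≫ x.2.1.f₁, x.2.1.f₂⟩) (by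
    rintro _ _ ⟨t, g, p⟩
    ext <;> simp [at₂])
  invFun q := mkL (T := seqSplit C) (P := (seqSplit C).at₂ X Y)
    (⟨q.f₀, q.f₂, q.f₃⟩ : SeqSplit A ⟨X.l, Y.r⟩ Z)
    (⟨𝟙 _, q.f₁, 𝟙 _⟩ : SeqSplit ⟨X.l, Y.r⟩ X Y)
  left_inv := by
    rintro ⟨⟨U, a, b⟩⟩
    have h := mkL_dinat (T := seqSplit C) (P := (seqSplit C).at₂ X Y) (Z := Z) a
      (⟨b.f₀, b.f₂⟩ : Hom U ⟨X.l, Y.r⟩) (⟨𝟙 _, b.f₁, 𝟙 _⟩ : SeqSplit ⟨X.l, Y.r⟩ X Y)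
    simp only [Category.id_comp, Category.comp_id, id_f₀, id_f₁] at h
    exact h
  right_inv q := by ext <;> simp [mkL]

/-- `(c | d) ↦ c₀ ⨾ □ ⨾ c₁ ⨾ d₀ ⨾ □ ⨾ d₁ ⨾ □ ⨾ d₂ ⨾ c₂` -/
def seqQuadR (A X Y Z : Obj C) :
    ((seqSplit C).fillR X ((seqSplit C).at₂ Y Z)).obj A ≃ Quad A X Y Z where
  toFun := Quot.lift (fun x => ⟨x.2.1.f₀, x.2.1.f₁ ≫ x.2.2.f₀, x.2.2.f₁, x.2.2.f₂ ≫ x.2.1.f₂⟩) (by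
    rintro _ _ ⟨t, g, p⟩
    ext <;> simp [at₂])
  invFun q := mkR (T := seqSplit C) (P := (seqSplit C).at₂ Y Z)
    (⟨q.f₀, q.f₁, q.f₃⟩ : SeqSplit A X ⟨Y.l, Z.r⟩)
    (⟨𝟙 _, q.f₂, 𝟙 _⟩ : SeqSplit ⟨Y.l, Z.r⟩ Y Z)
  left_inv := by
    rintro ⟨⟨U, a, b⟩⟩
    have h := mkR_dinat (T := seqSplit C) (P := (seqSplit C).at₂ Y Z) (X := X) a
      (⟨b.f₀, b.f₂⟩ : Hom U ⟨Y.l, Z.r⟩) (⟨𝟙 _, b.f₁, 𝟙 _⟩ : SeqSplit ⟨Y.l, Z.r⟩ Y Z)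
    simp only [Category.id_comp, Category.comp_id, id_f₀, id_f₁] at h
    exact h
  right_inv q := by ext <;> simp [mkR]

/-- The sequential left unitor, `(a | n) ↦ a₀ ⨾ n ⨾ a₁ ⨾ □ ⨾ a₂`. -/
def seqLam (A X : Obj C) : ((seqSplit C).fillL (seqUnit C) X).obj A ≃ (A ⟶ X) where
  toFun := Quot.lift (fun x => ⟨x.2.1.f₀ ≫ x.2.2 ≫ x.2.1.f₁, x.2.1.f₂⟩) (by
    rintro _ _ ⟨t, g, p⟩
    ext <;> simp)
  invFun f := mkL (T := seqSplit C) (P := seqUnit C)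
    (⟨𝟙 _, 𝟙 _, f.f₁⟩ : SeqSplit A ⟨A.l, X.l⟩ X) f.f₀
  left_inv := by
    rintro ⟨⟨U, a, n⟩⟩
    have h := mkL_dinat (T := seqSplit C) (P := seqUnit C)
      (⟨𝟙 _, 𝟙 _, a.f₂⟩ : SeqSplit A ⟨A.l, X.l⟩ X) (⟨a.f₀, a.f₁⟩ : Hom ⟨A.l, X.l⟩ U) n
    simp only [Category.id_comp, Category.comp_id, id_f₀, id_f₁] at h
    exact h.symm
  right_inv f := by ext <;> simp [mkL]

/-- The sequential right unitor, `(a | n) ↦ a₀ ⨾ □ ⨾ a₁ ⨾ n ⨾ a₂`. -/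
def seqRho (A X : Obj C) : ((seqSplit C).fillR X (seqUnit C)).obj A ≃ (A ⟶ X) where
  toFun := Quot.lift (fun x => ⟨x.2.1.f₀, x.2.1.f₁ ≫ x.2.2 ≫ x.2.1.f₂⟩) (by
    rintro _ _ ⟨t, g, p⟩
    ext <;> simp)
  invFun f := mkR (T := seqSplit C) (P := seqUnit C)
    (⟨f.f₀, 𝟙 _, 𝟙 _⟩ : SeqSplit A X ⟨X.r, A.r⟩) f.f₁
  left_inv := by
    rintro ⟨⟨U, a, n⟩⟩
    have h := mkR_dinat (T := seqSplit C) (P := seqUnit C)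
      (⟨a.f₀, 𝟙 _, 𝟙 _⟩ : SeqSplit A X ⟨X.r, A.r⟩) (⟨a.f₁, a.f₂⟩ : Hom ⟨X.r, A.r⟩ U) n
    simp only [Category.id_comp, Category.comp_id, id_f₀, id_f₁] at h
    exact h.symm
  right_inv f := by ext <;> simp [mkR]

theorem seqAssoc_iff {A X Y Z U W : Obj C} (a : SeqSplit A U Z) (b : SeqSplit U X Y)
    (c : SeqSplit A X W) (d : SeqSplit W Y Z) :
    ((seqQuadL A X Y Z).trans (seqQuadR A X Y Z).symm)
        (mkL (T := seqSplit C) (P := (seqSplit C).at₂ X Y) a b) =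
      mkR (T := seqSplit C) (P := (seqSplit C).at₂ Y Z) c d ↔
    a.f₀ ≫ b.f₀ = c.f₀ ∧ b.f₁ = c.f₁ ≫ d.f₀ ∧ b.f₂ ≫ a.f₁ = d.f₁ ∧ a.f₂ = d.f₂ ≫ c.f₂ := by
  rw [Equiv.trans_apply, Equiv.symm_apply_eq]
  exact Quad.ext_iff

@[simp] theorem seqLam_mk {A X U : Obj C} (a : SeqSplit A U X) (n : U.l ⟶ U.r) :
    seqLam A X (mkL (T := seqSplit C) (P := seqUnit C) a n) = ⟨a.f₀ ≫ n ≫ a.f₁, a.f₂⟩ := rfl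

@[simp] theorem seqRho_mk {A X U : Obj C} (a : SeqSplit A X U) (n : U.l ⟶ U.r) :
    seqRho A X (mkR (T := seqSplit C) (P := seqUnit C) a n) = ⟨a.f₀, a.f₁ ≫ n ≫ a.f₂⟩ := rfl

/-- A fourfold sequential composite depends only on the five resulting arrows. -/
theorem seqR_ext {A X Y Z W U K U' K' : Obj C} (a : SeqSplit A X U) (b : SeqSplit U Y K)
    (c : SeqSplit K Z W) (a' : SeqSplit A X U') (b' : SeqSplit U' Y K') (c' : SeqSplit K' Z W)
    (h₀ : a.f₀ = a'.f₀) (h₁ : a.f₁ ≫ b.f₀ = a'.f₁ ≫ b'.f₀)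
    (h₂ : b.f₁ ≫ c.f₀ = b'.f₁ ≫ c'.f₀) (h₃ : c.f₁ = c'.f₁)
    (h₄ : c.f₂ ≫ b.f₂ ≫ a.f₂ = c'.f₂ ≫ b'.f₂ ≫ a'.f₂) :
    (mkR (T := seqSplit C) a (mkR (T := seqSplit C) (P := (seqSplit C).at₂ Z W) b c) :
      ((seqSplit C).fillR X ((seqSplit C).fillR Y ((seqSplit C).at₂ Z W))).obj A) =
      mkR (T := seqSplit C) a' (mkR (T := seqSplit C) (P := (seqSplit C).at₂ Z W) b' c') := by
  have key : ∀ {U K : Obj C} (a : SeqSplit A X U) (b : SeqSplit U Y K) (c : SeqSplit K Z W),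
      (mkR (T := seqSplit C) a (mkR (T := seqSplit C) (P := (seqSplit C).at₂ Z W) b c) :
        ((seqSplit C).fillR X ((seqSplit C).fillR Y ((seqSplit C).at₂ Z W))).obj A) =
      mkR (T := seqSplit C)
        (⟨a.f₀, a.f₁ ≫ b.f₀, c.f₂ ≫ b.f₂ ≫ a.f₂⟩ : SeqSplit A X ⟨Y.l, W.r⟩)
        (mkR (T := seqSplit C) (P := (seqSplit C).at₂ Z W)
          (⟨𝟙 _, b.f₁ ≫ c.f₀, 𝟙 _⟩ : SeqSplit ⟨Y.l, W.r⟩ Y ⟨Z.l, W.r⟩)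
          (⟨𝟙 _, c.f₁, 𝟙 _⟩ : SeqSplit ⟨Z.l, W.r⟩ Z W)) := by
    intro U K a b c
    have h1 := mkR_dinat (T := seqSplit C) (P := (seqSplit C).at₂ Z W) b
      (⟨c.f₀, c.f₂⟩ : Hom K ⟨Z.l, W.r⟩) (⟨𝟙 _, c.f₁, 𝟙 _⟩ : SeqSplit ⟨Z.l, W.r⟩ Z W)
    have h2 := mkR_dinat (T := seqSplit C)
      (P := (seqSplit C).fillR Y ((seqSplit C).at₂ Z W)) a (⟨b.f₀, c.f₂ ≫ b.f₂⟩ : Hom U ⟨Y.l, W.r⟩)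
      (mkR (T := seqSplit C) (P := (seqSplit C).at₂ Z W)
          (⟨𝟙 _, b.f₁ ≫ c.f₀, 𝟙 _⟩ : SeqSplit ⟨Y.l, W.r⟩ Y ⟨Z.l, W.r⟩)
          (⟨𝟙 _, c.f₁, 𝟙 _⟩ : SeqSplit ⟨Z.l, W.r⟩ Z W))
    have h3 := congrArg (mkR (T := seqSplit C) (P := (seqSplit C).fillR Y ((seqSplit C).at₂ Z W)) a) h1
    simp only [Category.id_comp, Category.comp_id, Category.assoc, id_f₀, id_f₁] at h2 h3
    refine h3.symm.trans (Eq.trans ?_ h2.symm)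
    refine congrArg (mkR (T := seqSplit C) (P := (seqSplit C).fillR Y ((seqSplit C).at₂ Z W)) a) ?_
    refine congrArg (fun t => mkR (T := seqSplit C) (P := (seqSplit C).at₂ Z W) t
      (⟨𝟙 _, c.f₁, 𝟙 _⟩ : SeqSplit ⟨Z.l, W.r⟩ Z W)) ?_
    apply SeqSplit.ext <;> simp
  rw [key a b c, key a' b' c', h₀, h₁, h₂, h₃, h₄]

/-- The sequential promonoidal structure of the splice. -/
@[reducible]
def seq (C : Type u) [SmallCategory C] : Promonoidal (Obj C) where
  split := seqSplit C
  unit := seqUnit C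
  assoc A X Y Z := (seqQuadL A X Y Z).trans (seqQuadR A X Y Z).symm
  lam := seqLam
  rho := seqRho
  assoc_natural f g h k a b c d e := by
    obtain ⟨e₀, e₁, e₂, e₃⟩ := (seqAssoc_iff a b c d).1 e
    refine (seqAssoc_iff _ _ _ _).2 ⟨?_, ?_, ?_, ?_⟩
    · simp [← e₀]
    · simp [e₁]
    · simp [← e₂]
    · simp [e₃]
  lam_natural f g a n := by ext <;> simp
  rho_natural f g a n := by ext <;> simp
  pentagon a b c _ _ a₁ b₁ a₂ c₂ _ _ _ b₃ c₃ a₄ b₄ b₅ c₅ e₁ e₂ e₃ e₄ e₅ := by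
    obtain ⟨e₁₀, e₁₁, e₁₂, e₁₃⟩ := (seqAssoc_iff _ _ _ _).1 e₁
    obtain ⟨e₂₀, e₂₁, e₂₂, e₂₃⟩ := (seqAssoc_iff _ _ _ _).1 e₂
    obtain ⟨e₃₀, e₃₁, e₃₂, e₃₃⟩ := (seqAssoc_iff _ _ _ _).1 e₃
    obtain ⟨e₄₀, e₄₁, e₄₂, e₄₃⟩ := (seqAssoc_iff _ _ _ _).1 e₄
    obtain ⟨e₅₀, e₅₁, e₅₂, e₅₃⟩ := (seqAssoc_iff _ _ _ _).1 e₅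
    apply seqR_ext
    · rw [← e₂₀, ← e₁₀, ← e₄₀, ← e₃₀, Category.assoc]
    · rw [← e₂₁, e₃₁, e₄₁, ← e₅₀, Category.assoc]
    · rw [← e₂₂, Category.assoc, ← e₁₁, ← e₅₁, e₃₂]
    · rw [← e₁₂, ← e₅₂, ← e₄₂, e₃₃, Category.assoc]
    · rw [← e₂₃, ← e₁₃, e₄₃, e₅₃, Category.assoc]
  triangle a b n c d e := by
    obtain ⟨e₀, e₁, e₂, e₃⟩ := (seqAssoc_iff _ _ _ _).1 e
    apply SeqSplit.ext
    · simp [e₀]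
    · simp [e₁, ← e₂]
    · simp [e₃]

/-- If `P` and `Q` are generated by the elements `u` and `v`, every element of the coend can be
moved onto them. -/
theorem mk₂_ext {V : Type u} [SmallCategory V] {T : SplitProf V} {P Q : UnitProf V}
    {A x y U W U' W' : V} {u : P.obj x} {v : Q.obj y} {t : T.obj A U W} {t' : T.obj A U' W'}
    {p : P.obj U} {q : Q.obj W} {p' : P.obj U'} {q' : Q.obj W'} (g : U ⟶ x) (h : W ⟶ y)
    (g' : U' ⟶ x) (h' : W' ⟶ y) (hp : p = P.act g u) (hq : q = Q.act h v)
    (hp' : p' = P.act g' u) (hq' : q' = Q.act h' v)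
    (e : T.act (𝟙 A) t g h = T.act (𝟙 A) t' g' h') :
    (mk₂ t p q : (T.conv P Q).obj A) = mk₂ t' p' q' := by
  rw [hp, hq, hp', hq', ← mk₂_dinat, ← mk₂_dinat, e]

/-- a nested sequential composite depends only on the resulting arrows -/
theorem seqConv_ext {P Q R : UnitProf (Obj C)} {x y z A G H L L' G' H' M M' : Obj C}
    {u : P.obj x} {v : Q.obj y} {w : R.obj z}
    {r : SeqSplit A G H} {r' : SeqSplit H L L'} {p : P.obj G} {q : Q.obj L} {s : R.obj L'}
    {t : SeqSplit A G' H'} {t' : SeqSplit H' M M'} {p' : P.obj G'} {q' : Q.obj M} {s' : R.obj M'}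
    (g : G ⟶ x) (h : L ⟶ y) (k : L' ⟶ z) (g' : G' ⟶ x) (h' : M ⟶ y) (k' : M' ⟶ z)
    (hp : p = P.act g u) (hq : q = Q.act h v) (hs : s = R.act k w)
    (hp' : p' = P.act g' u) (hq' : q' = Q.act h' v) (hs' : s' = R.act k' w)
    (e₀ : r.f₀ ≫ g.f₀ = t.f₀ ≫ g'.f₀)
    (e₁ : g.f₁ ≫ r.f₁ ≫ r'.f₀ ≫ h.f₀ = g'.f₁ ≫ t.f₁ ≫ t'.f₀ ≫ h'.f₀)
    (e₂ : h.f₁ ≫ r'.f₁ ≫ k.f₀ = h'.f₁ ≫ t'.f₁ ≫ k'.f₀)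
    (e₃ : k.f₁ ≫ r'.f₂ ≫ r.f₂ = k'.f₁ ≫ t'.f₂ ≫ t.f₂) :
    (mk₂ (T := seqSplit C) r p (mk₂ (T := seqSplit C) r' q s) :
      ((seqSplit C).conv P ((seqSplit C).conv Q R)).obj A) =
      mk₂ (T := seqSplit C) t p' (mk₂ (T := seqSplit C) t' q' s') := by
  have key : ∀ {H L L' : Obj C} (r' : SeqSplit H L L') (h : L ⟶ y) (k : L' ⟶ z),
      (mk₂ (T := seqSplit C) r' (Q.act h v) (R.act k w) : ((seqSplit C).conv Q R).obj H) =
      ((seqSplit C).conv Q R).act (⟨r'.f₀ ≫ h.f₀, k.f₁ ≫ r'.f₂⟩ : Hom H ⟨y.l, z.r⟩)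
        (mk₂ (T := seqSplit C) (⟨𝟙 _, h.f₁ ≫ r'.f₁ ≫ k.f₀, 𝟙 _⟩ : SeqSplit ⟨y.l, z.r⟩ y z)
          v w) := by
    intro H L L' r' h k
    rw [← mk₂_dinat]
    refine congrArg (fun t => mk₂ (T := seqSplit C) t v w) ?_
    apply SeqSplit.ext <;> simp
  subst hp hq hs hp' hq' hs'
  rw [key r' h k, key t' h' k', e₂, ← mk₂_dinat, ← mk₂_dinat]
  refine congrArg (fun t => mk₂ (T := seqSplit C) t u _) ?_
  apply SeqSplit.ext
  · simpa using e₀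
  · simpa using e₁
  · simpa using e₃

variable [MonoidalCategory C]

/-- Parallel splits `f₀ ⨾ (□ ⊗ □) ⨾ f₁`. -/
@[ext]
structure ParSplit (A X Y : Obj C) where
  f₀ : A.l ⟶ X.l ⊗ Y.l
  f₁ : X.r ⊗ Y.r ⟶ A.r

/-- Parallel units `f₀ ∥ f₁`. -/
@[ext]
structure ParUnit (A : Obj C) where
  f₀ : A.l ⟶ 𝟙_ C
  f₁ : 𝟙_ C ⟶ A.r

/-- The profunctor of parallel splits. -/
@[reducible]
def parSplit (C : Type u) [SmallCategory C] [MonoidalCategory C] : SplitProf (Obj C) where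
  obj A X Y := ParSplit A X Y
  act f t g h := ⟨f.f₀ ≫ t.f₀ ≫ (g.f₀ ⊗ₘ h.f₀), (g.f₁ ⊗ₘ h.f₁) ≫ t.f₁ ≫ f.f₁⟩
  act_id t := by ext <;> simp
  act_comp f' f t g g' h h' := by ext <;> simp

/-- The profunctor of parallel units. -/
@[reducible]
def parUnit (C : Type u) [SmallCategory C] [MonoidalCategory C] : UnitProf (Obj C) where
  obj A := ParUnit A
  act f i := ⟨f.f₀ ≫ i.f₀, i.f₁ ≫ f.f₁⟩
  act_id i := by ext <;> simp
  act_comp f' f i := by ext <;> simp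

/-- `(a | b) ↦ a₀ ⨾ (b₀ ⊗ 1) ⨾ α ⨾ (□ ⊗ (□ ⊗ □)) ⨾ α⁻¹ ⨾ (b₁ ⊗ 1) ⨾ a₁` -/
def parTriL (A X Y Z : Obj C) :
    ((parSplit C).fillL ((parSplit C).at₂ X Y) Z).obj A ≃
      (A ⟶ ⟨X.l ⊗ (Y.l ⊗ Z.l), X.r ⊗ (Y.r ⊗ Z.r)⟩) where
  toFun := Quot.lift (fun x => ⟨x.2.1.f₀ ≫ (x.2.2.f₀ ▷ Z.l) ≫ (α_ _ _ _).hom,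
      (α_ _ _ _).inv ≫ (x.2.2.f₁ ▷ Z.r) ≫ x.2.1.f₁⟩) (by
    rintro _ _ ⟨t, g, p⟩
    ext <;> simp)
  invFun q := mkL (T := parSplit C) (P := (parSplit C).at₂ X Y)
    (⟨q.f₀ ≫ (α_ _ _ _).inv, (α_ _ _ _).hom ≫ q.f₁⟩ : ParSplit A ⟨X.l ⊗ Y.l, X.r ⊗ Y.r⟩ Z)
    (⟨𝟙 _, 𝟙 _⟩ : ParSplit ⟨X.l ⊗ Y.l, X.r ⊗ Y.r⟩ X Y)
  left_inv := by
    rintro ⟨⟨U, a, b⟩⟩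
    have h := mkL_dinat (T := parSplit C) (P := (parSplit C).at₂ X Y) (Z := Z) a
      (⟨b.f₀, b.f₁⟩ : Hom U ⟨X.l ⊗ Y.l, X.r ⊗ Y.r⟩)
      (⟨𝟙 _, 𝟙 _⟩ : ParSplit ⟨X.l ⊗ Y.l, X.r ⊗ Y.r⟩ X Y)
    simp only [Category.id_comp, Category.comp_id, id_f₀, id_f₁, tensorHom_id,
      id_whiskerRight] at h
    refine Eq.trans ?_ h
    simp
  right_inv q := by ext <;> simp [mkL]

/-- `(c | d) ↦ c₀ ⨾ (1 ⊗ d₀) ⨾ (□ ⊗ (□ ⊗ □)) ⨾ (1 ⊗ d₁) ⨾ c₁` -/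
def parTriR (A X Y Z : Obj C) :
    ((parSplit C).fillR X ((parSplit C).at₂ Y Z)).obj A ≃
      (A ⟶ ⟨X.l ⊗ (Y.l ⊗ Z.l), X.r ⊗ (Y.r ⊗ Z.r)⟩) where
  toFun := Quot.lift (fun x => ⟨x.2.1.f₀ ≫ (X.l ◁ x.2.2.f₀), (X.r ◁ x.2.2.f₁) ≫ x.2.1.f₁⟩) (by
    rintro _ _ ⟨t, g, p⟩
    ext <;> simp)
  invFun q := mkR (T := parSplit C) (P := (parSplit C).at₂ Y Z)
    (⟨q.f₀, q.f₁⟩ : ParSplit A X ⟨Y.l ⊗ Z.l, Y.r ⊗ Z.r⟩)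
    (⟨𝟙 _, 𝟙 _⟩ : ParSplit ⟨Y.l ⊗ Z.l, Y.r ⊗ Z.r⟩ Y Z)
  left_inv := by
    rintro ⟨⟨U, a, b⟩⟩
    have h := mkR_dinat (T := parSplit C) (P := (parSplit C).at₂ Y Z) (X := X) a
      (⟨b.f₀, b.f₁⟩ : Hom U ⟨Y.l ⊗ Z.l, Y.r ⊗ Z.r⟩)
      (⟨𝟙 _, 𝟙 _⟩ : ParSplit ⟨Y.l ⊗ Z.l, Y.r ⊗ Z.r⟩ Y Z)
    simp only [Category.id_comp, Category.comp_id, id_f₀, id_f₁, id_tensorHom,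
      tensorHom_id, id_whiskerRight] at h
    exact h
  right_inv q := by ext <;> simp [mkR]

/-- The parallel left unitor, `(a | i) ↦ a₀ ⨾ (i₀ ⊗ 1) ⨾ λ ⨾ □ ⨾ λ⁻¹ ⨾ (i₁ ⊗ 1) ⨾ a₁`. -/
def parLam (A X : Obj C) : ((parSplit C).fillL (parUnit C) X).obj A ≃ (A ⟶ X) where
  toFun := Quot.lift (fun x => ⟨x.2.1.f₀ ≫ (x.2.2.f₀ ▷ X.l) ≫ (λ_ X.l).hom,
      (λ_ X.r).inv ≫ (x.2.2.f₁ ▷ X.r) ≫ x.2.1.f₁⟩) (by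
    rintro _ _ ⟨t, g, p⟩
    ext <;> simp)
  invFun f := mkL (T := parSplit C) (P := parUnit C)
    (⟨f.f₀ ≫ (λ_ X.l).inv, (λ_ X.r).hom ≫ f.f₁⟩ : ParSplit A ⟨𝟙_ C, 𝟙_ C⟩ X)
    (⟨𝟙 _, 𝟙 _⟩ : ParUnit ⟨𝟙_ C, 𝟙_ C⟩)
  left_inv := by
    rintro ⟨⟨U, a, i⟩⟩
    have h := mkL_dinat (T := parSplit C) (P := parUnit C) (Z := X) a
      (⟨i.f₀, i.f₁⟩ : Hom U ⟨𝟙_ C, 𝟙_ C⟩) (⟨𝟙 _, 𝟙 _⟩ : ParUnit ⟨𝟙_ C, 𝟙_ C⟩)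
    simp only [Category.id_comp, Category.comp_id, id_f₀, id_f₁, tensorHom_id] at h
    refine Eq.trans ?_ h
    simp
  right_inv f := by ext <;> simp [mkL]

/-- The parallel right unitor, `(a | i) ↦ a₀ ⨾ (1 ⊗ i₀) ⨾ ρ ⨾ □ ⨾ ρ⁻¹ ⨾ (1 ⊗ i₁) ⨾ a₁`. -/
def parRho (A X : Obj C) : ((parSplit C).fillR X (parUnit C)).obj A ≃ (A ⟶ X) where
  toFun := Quot.lift (fun x => ⟨x.2.1.f₀ ≫ (X.l ◁ x.2.2.f₀) ≫ (ρ_ X.l).hom,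
      (ρ_ X.r).inv ≫ (X.r ◁ x.2.2.f₁) ≫ x.2.1.f₁⟩) (by
    rintro _ _ ⟨t, g, p⟩
    ext <;> simp)
  invFun f := mkR (T := parSplit C) (P := parUnit C)
    (⟨f.f₀ ≫ (ρ_ X.l).inv, (ρ_ X.r).hom ≫ f.f₁⟩ : ParSplit A X ⟨𝟙_ C, 𝟙_ C⟩)
    (⟨𝟙 _, 𝟙 _⟩ : ParUnit ⟨𝟙_ C, 𝟙_ C⟩)
  left_inv := by
    rintro ⟨⟨U, a, i⟩⟩
    have h := mkR_dinat (T := parSplit C) (P := parUnit C) (X := X) a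
      (⟨i.f₀, i.f₁⟩ : Hom U ⟨𝟙_ C, 𝟙_ C⟩) (⟨𝟙 _, 𝟙 _⟩ : ParUnit ⟨𝟙_ C, 𝟙_ C⟩)
    simp only [Category.id_comp, Category.comp_id, id_f₀, id_f₁, id_tensorHom] at h
    refine Eq.trans ?_ h
    simp
  right_inv f := by ext <;> simp [mkR]

@[simp] theorem parLam_mk {A X U : Obj C} (a : ParSplit A U X) (i : ParUnit U) :
    parLam A X (mkL (T := parSplit C) (P := parUnit C) a i) =
      ⟨a.f₀ ≫ (i.f₀ ▷ X.l) ≫ (λ_ X.l).hom, (λ_ X.r).inv ≫ (i.f₁ ▷ X.r) ≫ a.f₁⟩ := rfl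

@[simp] theorem parRho_mk {A X U : Obj C} (a : ParSplit A X U) (i : ParUnit U) :
    parRho A X (mkR (T := parSplit C) (P := parUnit C) a i) =
      ⟨a.f₀ ≫ (X.l ◁ i.f₀) ≫ (ρ_ X.l).hom, (ρ_ X.r).inv ≫ (X.r ◁ i.f₁) ≫ a.f₁⟩ := rfl

theorem parAssoc_iff {A X Y Z U W : Obj C} (a : ParSplit A U Z) (b : ParSplit U X Y)
    (c : ParSplit A X W) (d : ParSplit W Y Z) :
    ((parTriL A X Y Z).trans (parTriR A X Y Z).symm)
        (mkL (T := parSplit C) (P := (parSplit C).at₂ X Y) a b) =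
      mkR (T := parSplit C) (P := (parSplit C).at₂ Y Z) c d ↔
    a.f₀ ≫ (b.f₀ ▷ Z.l) ≫ (α_ _ _ _).hom = c.f₀ ≫ (X.l ◁ d.f₀) ∧
      (α_ _ _ _).inv ≫ (b.f₁ ▷ Z.r) ≫ a.f₁ = (X.r ◁ d.f₁) ≫ c.f₁ := by
  rw [Equiv.trans_apply, Equiv.symm_apply_eq]
  exact Hom.ext_iff

/-- A fourfold parallel composite depends only on the two resulting arrows. -/
theorem parR_ext {A X Y Z W U K U' K' : Obj C} (a : ParSplit A X U) (b : ParSplit U Y K)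
    (c : ParSplit K Z W) (a' : ParSplit A X U') (b' : ParSplit U' Y K') (c' : ParSplit K' Z W)
    (h₀ : a.f₀ ≫ (X.l ◁ (b.f₀ ≫ (Y.l ◁ c.f₀))) = a'.f₀ ≫ (X.l ◁ (b'.f₀ ≫ (Y.l ◁ c'.f₀))))
    (h₁ : (X.r ◁ ((Y.r ◁ c.f₁) ≫ b.f₁)) ≫ a.f₁ = (X.r ◁ ((Y.r ◁ c'.f₁) ≫ b'.f₁)) ≫ a'.f₁) :
    (mkR (T := parSplit C) a (mkR (T := parSplit C) (P := (parSplit C).at₂ Z W) b c) :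
      ((parSplit C).fillR X ((parSplit C).fillR Y ((parSplit C).at₂ Z W))).obj A) =
      mkR (T := parSplit C) a' (mkR (T := parSplit C) (P := (parSplit C).at₂ Z W) b' c') := by
  have key : ∀ {U K : Obj C} (a : ParSplit A X U) (b : ParSplit U Y K) (c : ParSplit K Z W),
      (mkR (T := parSplit C) a (mkR (T := parSplit C) (P := (parSplit C).at₂ Z W) b c) :
        ((parSplit C).fillR X ((parSplit C).fillR Y ((parSplit C).at₂ Z W))).obj A) =
      mkR (T := parSplit C)
        (⟨a.f₀ ≫ (X.l ◁ (b.f₀ ≫ (Y.l ◁ c.f₀))), (X.r ◁ ((Y.r ◁ c.f₁) ≫ b.f₁)) ≫ a.f₁⟩ :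
          ParSplit A X ⟨Y.l ⊗ (Z.l ⊗ W.l), Y.r ⊗ (Z.r ⊗ W.r)⟩)
        (mkR (T := parSplit C) (P := (parSplit C).at₂ Z W)
          (⟨𝟙 _, 𝟙 _⟩ : ParSplit ⟨Y.l ⊗ (Z.l ⊗ W.l), Y.r ⊗ (Z.r ⊗ W.r)⟩ Y
            ⟨Z.l ⊗ W.l, Z.r ⊗ W.r⟩)
          (⟨𝟙 _, 𝟙 _⟩ : ParSplit ⟨Z.l ⊗ W.l, Z.r ⊗ W.r⟩ Z W)) := by
    intro U K a b c
    have h1 := mkR_dinat (T := parSplit C) (P := (parSplit C).at₂ Z W) b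
      (⟨c.f₀, c.f₁⟩ : Hom K ⟨Z.l ⊗ W.l, Z.r ⊗ W.r⟩)
      (⟨𝟙 _, 𝟙 _⟩ : ParSplit ⟨Z.l ⊗ W.l, Z.r ⊗ W.r⟩ Z W)
    have h2 := mkR_dinat (T := parSplit C)
      (P := (parSplit C).fillR Y ((parSplit C).at₂ Z W)) a
      (⟨b.f₀ ≫ (Y.l ◁ c.f₀), (Y.r ◁ c.f₁) ≫ b.f₁⟩ :
        Hom U ⟨Y.l ⊗ (Z.l ⊗ W.l), Y.r ⊗ (Z.r ⊗ W.r)⟩)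
      (mkR (T := parSplit C) (P := (parSplit C).at₂ Z W)
          (⟨𝟙 _, 𝟙 _⟩ : ParSplit ⟨Y.l ⊗ (Z.l ⊗ W.l), Y.r ⊗ (Z.r ⊗ W.r)⟩ Y
            ⟨Z.l ⊗ W.l, Z.r ⊗ W.r⟩)
          (⟨𝟙 _, 𝟙 _⟩ : ParSplit ⟨Z.l ⊗ W.l, Z.r ⊗ W.r⟩ Z W))
    have h3 := congrArg
      (mkR (T := parSplit C) (P := (parSplit C).fillR Y ((parSplit C).at₂ Z W)) a) h1
    simp only [Category.id_comp, Category.comp_id, id_f₀, id_f₁, id_tensorHom,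
      tensorHom_id, id_whiskerRight] at h2 h3
    refine h3.symm.trans (Eq.trans ?_ h2.symm)
    refine congrArg
      (mkR (T := parSplit C) (P := (parSplit C).fillR Y ((parSplit C).at₂ Z W)) a) ?_
    refine congrArg (fun t => mkR (T := parSplit C) (P := (parSplit C).at₂ Z W) t
      (⟨𝟙 _, 𝟙 _⟩ : ParSplit ⟨Z.l ⊗ W.l, Z.r ⊗ W.r⟩ Z W)) ?_
    apply ParSplit.ext <;> simp
  rw [key a b c, key a' b' c', h₀, h₁]

theorem par_natural₀ {A' A U X Y Z X' Y' Z' W : C} (f : A' ⟶ A) (a : A ⟶ U ⊗ Z) (b : U ⟶ X ⊗ Y)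
    (c : A ⟶ X ⊗ W) (d : W ⟶ Y ⊗ Z) (g : X ⟶ X') (h : Y ⟶ Y') (k : Z ⟶ Z')
    (e : a ≫ b ▷ Z ≫ (α_ X Y Z).hom = c ≫ X ◁ d) :
    (f ≫ a ≫ (𝟙 U ⊗ₘ k)) ≫ ((𝟙 U ≫ b ≫ (g ⊗ₘ h)) ▷ Z') ≫ (α_ X' Y' Z').hom =
      (f ≫ c ≫ (g ⊗ₘ 𝟙 W)) ≫ (X' ◁ (𝟙 W ≫ d ≫ (h ⊗ₘ k))) := by
  have l : (f ≫ a ≫ (𝟙 U ⊗ₘ k)) ≫ ((𝟙 U ≫ b ≫ (g ⊗ₘ h)) ▷ Z') ≫ (α_ X' Y' Z').hom =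
      f ≫ (a ≫ b ▷ Z ≫ (α_ X Y Z).hom) ≫ (g ⊗ₘ (h ⊗ₘ k)) := by
    simp only [Category.assoc, ← associator_naturality, ← tensorHom_id,
      tensorHom_comp_tensorHom_assoc, Category.id_comp, Category.comp_id]
  rw [l, e]
  simp only [Category.assoc, ← id_tensorHom, tensorHom_comp_tensorHom,
      Category.id_comp, Category.comp_id]

theorem par_natural₁ {A' A U X Y Z X' Y' Z' W : C} (f : A ⟶ A') (a : U ⊗ Z ⟶ A) (b : X ⊗ Y ⟶ U)
    (c : X ⊗ W ⟶ A) (d : Y ⊗ Z ⟶ W) (g : X' ⟶ X) (h : Y' ⟶ Y) (k : Z' ⟶ Z)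
    (e : (α_ X Y Z).inv ≫ b ▷ Z ≫ a = X ◁ d ≫ c) :
    (α_ X' Y' Z').inv ≫ (((g ⊗ₘ h) ≫ b ≫ 𝟙 U) ▷ Z') ≫ ((𝟙 U ⊗ₘ k) ≫ a ≫ f) =
      (X' ◁ ((h ⊗ₘ k) ≫ d ≫ 𝟙 W)) ≫ ((g ⊗ₘ 𝟙 W) ≫ c ≫ f) := by
  have l : (α_ X' Y' Z').inv ≫ (((g ⊗ₘ h) ≫ b ≫ 𝟙 U) ▷ Z') ≫ ((𝟙 U ⊗ₘ k) ≫ a ≫ f) =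
      (g ⊗ₘ (h ⊗ₘ k)) ≫ ((α_ X Y Z).inv ≫ b ▷ Z ≫ a) ≫ f := by
    simp only [Category.assoc, associator_inv_naturality_assoc, ← tensorHom_id,
      tensorHom_comp_tensorHom_assoc, Category.id_comp, Category.comp_id]
  rw [l, e]
  simp only [Category.assoc, ← id_tensorHom, tensorHom_comp_tensorHom_assoc,
      Category.id_comp, Category.comp_id]

theorem par_pentagon₀ {A U W U' Z X Y P Q R S K : C} (a : A ⟶ U ⊗ W) (b : U ⟶ U' ⊗ Z)
    (c : U' ⟶ X ⊗ Y) (a₁ : A ⟶ U' ⊗ P) (b₁ : P ⟶ Z ⊗ W) (a₂ : A ⟶ X ⊗ Q) (c₂ : Q ⟶ Y ⊗ P)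
    (b₃ : U ⟶ X ⊗ R) (c₃ : R ⟶ Y ⊗ Z) (a₄ : A ⟶ X ⊗ S) (b₄ : S ⟶ R ⊗ W) (b₅ : S ⟶ Y ⊗ K)
    (c₅ : K ⟶ Z ⊗ W)
    (e₁ : a ≫ b ▷ W ≫ (α_ _ _ _).hom = a₁ ≫ U' ◁ b₁)
    (e₂ : a₁ ≫ c ▷ P ≫ (α_ _ _ _).hom = a₂ ≫ X ◁ c₂)
    (e₃ : b ≫ c ▷ Z ≫ (α_ _ _ _).hom = b₃ ≫ X ◁ c₃)
    (e₄ : a ≫ b₃ ▷ W ≫ (α_ _ _ _).hom = a₄ ≫ X ◁ b₄)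
    (e₅ : b₄ ≫ c₃ ▷ W ≫ (α_ _ _ _).hom = b₅ ≫ Y ◁ c₅) :
    a₂ ≫ X ◁ (c₂ ≫ Y ◁ b₁) = a₄ ≫ X ◁ (b₅ ≫ Y ◁ c₅) := by
  have h1 : a₂ ≫ X ◁ (c₂ ≫ Y ◁ b₁) =
      a ≫ b ▷ W ≫ (α_ _ _ _).hom ≫ c ▷ (Z ⊗ W) ≫ (α_ _ _ _).hom := by
    rw [MonoidalCategory.whiskerLeft_comp, ← reassoc_of% e₂, ← associator_naturality_right,
      ← whisker_exchange_assoc, ← reassoc_of% e₁]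
  have h2 : a₄ ≫ X ◁ (b₅ ≫ Y ◁ c₅) =
      a ≫ (b ≫ c ▷ Z ≫ (α_ _ _ _).hom) ▷ W ≫ (α_ _ _ _).hom ≫ X ◁ (α_ _ _ _).hom := by
    rw [← e₅, MonoidalCategory.whiskerLeft_comp, ← reassoc_of% e₄, e₃]
    simp
  rw [h1, h2]
  simp

theorem par_pentagon₁ {A U W U' Z X Y P Q R S K : C} (a : U ⊗ W ⟶ A) (b : U' ⊗ Z ⟶ U)
    (c : X ⊗ Y ⟶ U') (a₁ : U' ⊗ P ⟶ A) (b₁ : Z ⊗ W ⟶ P) (a₂ : X ⊗ Q ⟶ A) (c₂ : Y ⊗ P ⟶ Q)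
    (b₃ : X ⊗ R ⟶ U) (c₃ : Y ⊗ Z ⟶ R) (a₄ : X ⊗ S ⟶ A) (b₄ : R ⊗ W ⟶ S) (b₅ : Y ⊗ K ⟶ S)
    (c₅ : Z ⊗ W ⟶ K)
    (e₁ : (α_ _ _ _).inv ≫ b ▷ W ≫ a = U' ◁ b₁ ≫ a₁)
    (e₂ : (α_ _ _ _).inv ≫ c ▷ P ≫ a₁ = X ◁ c₂ ≫ a₂)
    (e₃ : (α_ _ _ _).inv ≫ c ▷ Z ≫ b = X ◁ c₃ ≫ b₃)
    (e₄ : (α_ _ _ _).inv ≫ b₃ ▷ W ≫ a = X ◁ b₄ ≫ a₄)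
    (e₅ : (α_ _ _ _).inv ≫ c₃ ▷ W ≫ b₄ = Y ◁ c₅ ≫ b₅) :
    X ◁ (Y ◁ b₁ ≫ c₂) ≫ a₂ = X ◁ (Y ◁ c₅ ≫ b₅) ≫ a₄ := by
  have h1 : X ◁ (Y ◁ b₁ ≫ c₂) ≫ a₂ =
      (α_ _ _ _).inv ≫ c ▷ (Z ⊗ W) ≫ (α_ _ _ _).inv ≫ b ▷ W ≫ a := by
    rw [MonoidalCategory.whiskerLeft_comp, Category.assoc, ← e₂,
      associator_inv_naturality_right_assoc, whisker_exchange_assoc, ← e₁]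
  have h2 : X ◁ (Y ◁ c₅ ≫ b₅) ≫ a₄ =
      X ◁ (α_ _ _ _).inv ≫ (α_ _ _ _).inv ≫ ((α_ _ _ _).inv ≫ c ▷ Z ≫ b) ▷ W ≫ a := by
    rw [← e₅, MonoidalCategory.whiskerLeft_comp, MonoidalCategory.whiskerLeft_comp, Category.assoc,
      Category.assoc, ← e₄, e₃]
    simp
  rw [h1, h2]
  simp

/-- The parallel promonoidal structure of the splice. -/
@[reducible]
def par (C : Type u) [SmallCategory C] [MonoidalCategory C] : Promonoidal (Obj C) where
  split := parSplit C
  unit := parUnit C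
  assoc A X Y Z := (parTriL A X Y Z).trans (parTriR A X Y Z).symm
  lam := parLam
  rho := parRho
  assoc_natural f g h k a b c d e := by
    obtain ⟨e₀, e₁⟩ := (parAssoc_iff a b c d).1 e
    exact (parAssoc_iff _ _ _ _).2
      ⟨par_natural₀ _ _ _ _ _ _ _ _ e₀, par_natural₁ _ _ _ _ _ _ _ _ e₁⟩
  lam_natural f g a n := by
    ext
    · simp [tensorHom_def', whisker_exchange_assoc]
    · simp [MonoidalCategory.tensorHom_def, ← whisker_exchange_assoc]
  rho_natural f g a n := by
    ext
    · simp [MonoidalCategory.tensorHom_def, ← whisker_exchange_assoc]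
    · simp [tensorHom_def', whisker_exchange_assoc]
  pentagon a b c _ _ a₁ b₁ a₂ c₂ _ _ _ b₃ c₃ a₄ b₄ b₅ c₅ e₁ e₂ e₃ e₄ e₅ := by
    obtain ⟨e₁₀, e₁₁⟩ := (parAssoc_iff _ _ _ _).1 e₁
    obtain ⟨e₂₀, e₂₁⟩ := (parAssoc_iff _ _ _ _).1 e₂
    obtain ⟨e₃₀, e₃₁⟩ := (parAssoc_iff _ _ _ _).1 e₃
    obtain ⟨e₄₀, e₄₁⟩ := (parAssoc_iff _ _ _ _).1 e₄
    obtain ⟨e₅₀, e₅₁⟩ := (parAssoc_iff _ _ _ _).1 e₅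
    apply parR_ext
    · exact par_pentagon₀ _ _ _ _ _ _ _ _ _ _ _ _ _ e₁₀ e₂₀ e₃₀ e₄₀ e₅₀
    · exact par_pentagon₁ _ _ _ _ _ _ _ _ _ _ _ _ _ e₁₁ e₂₁ e₃₁ e₄₁ e₅₁
  triangle a b n c d e := by
    obtain ⟨e₀, e₁⟩ := (parAssoc_iff _ _ _ _).1 e
    apply ParSplit.ext
    · simp only [parRho_mk, parLam_mk, Category.id_comp, id_tensorHom, tensorHom_id,
        MonoidalCategory.whiskerLeft_comp, ← reassoc_of% e₀, comp_whiskerRight, id_f₀]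
      simp
    · simp only [parRho_mk, parLam_mk, Category.comp_id, id_tensorHom, tensorHom_id,
        MonoidalCategory.whiskerLeft_comp, Category.assoc, ← e₁, comp_whiskerRight, id_f₁]
      simp

/-- The pair of tensors, which represents the parallel splits. -/
@[reducible]
def tens (X Y : Obj C) : Obj C := ⟨X.l ⊗ Y.l, X.r ⊗ Y.r⟩

/-- The pair of units, which represents the parallel units. -/
@[reducible]
def triv (C : Type u) [SmallCategory C] [MonoidalCategory C] : Obj C := ⟨𝟙_ C, 𝟙_ C⟩

/-- the universal parallel split -/
@[reducible]
def parGen (X Y : Obj C) : ParSplit (tens X Y) X Y := ⟨𝟙 _, 𝟙 _⟩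

/-- the universal parallel unit -/
@[reducible]
def unitGen (C : Type u) [SmallCategory C] [MonoidalCategory C] : ParUnit (triv C) := ⟨𝟙 _, 𝟙 _⟩

/-- the arrow that a parallel split amounts to -/
@[reducible]
def ParSplit.hom {A X Y : Obj C} (t : ParSplit A X Y) : A ⟶ tens X Y := (⟨t.f₀, t.f₁⟩ : Hom _ _)

/-- the arrow that a parallel unit amounts to -/
@[reducible]
def ParUnit.hom {A : Obj C} (t : ParUnit A) : A ⟶ triv C := (⟨t.f₀, t.f₁⟩ : Hom _ _)

theorem ParSplit.eq_act {A X Y : Obj C} (t : ParSplit A X Y) :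
    t = ((parSplit C).at₂ X Y).act t.hom (parGen X Y) := by
  ext <;> simp

theorem ParUnit.eq_act {A : Obj C} (t : ParUnit A) :
    t = (parUnit C).act t.hom (unitGen C) := by
  ext <;> simp

/-- `(d | e | e') ↦ d₀ ⨾ e₀ ⨾ (□ ⊗ □) ⨾ e₁ ⨾ d₁ ⨾ e'₀ ⨾ (□ ⊗ □) ⨾ e'₁ ⨾ d₂` -/
def seqPar (A X Y Z W : Obj C) :
    ((seqSplit C).conv ((parSplit C).at₂ X Z) ((parSplit C).at₂ Y W)).obj A ≃
      SeqSplit A (tens X Z) (tens Y W) where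
  toFun := Quot.lift (fun x => ⟨x.2.2.1.f₀ ≫ x.2.2.2.1.f₀, x.2.2.2.1.f₁ ≫ x.2.2.1.f₁ ≫
      x.2.2.2.2.f₀, x.2.2.2.2.f₁ ≫ x.2.2.1.f₂⟩) (by
    rintro _ _ ⟨t, g, h, p, q⟩
    ext <;> simp)
  invFun q := mk₂ (T := seqSplit C) (P := (parSplit C).at₂ X Z) (Q := (parSplit C).at₂ Y W)
    q (parGen X Z) (parGen Y W)
  left_inv := by
    rintro ⟨⟨U, U', a, b, c⟩⟩
    refine mk₂_ext (T := seqSplit C) (P := (parSplit C).at₂ X Z) (Q := (parSplit C).at₂ Y W)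
      (𝟙 _) (𝟙 _) b.hom c.hom (((parSplit C).at₂ X Z).act_id _).symm
      (((parSplit C).at₂ Y W).act_id _).symm b.eq_act c.eq_act ?_
    apply SeqSplit.ext <;> simp
  right_inv q := by ext <;> simp [mk₂]

/-- `(a | b | c) ↦ a₀ ⨾ (b₀ ⊗ c₀) ⨾ (□ ⊗ □) ⨾ (b₁ ⊗ c₁) ⨾ (□ ⊗ □) ⨾ (b₂ ⊗ c₂) ⨾ a₁` -/
def parSeq (A X Y Z W : Obj C) :
    ((parSplit C).conv ((seqSplit C).at₂ X Y) ((seqSplit C).at₂ Z W)).obj A →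
      SeqSplit A (tens X Z) (tens Y W) :=
  Quot.lift (fun x => ⟨x.2.2.1.f₀ ≫ (x.2.2.2.1.f₀ ⊗ₘ x.2.2.2.2.f₀),
      x.2.2.2.1.f₁ ⊗ₘ x.2.2.2.2.f₁, (x.2.2.2.1.f₂ ⊗ₘ x.2.2.2.2.f₂) ≫ x.2.2.1.f₁⟩) (by
    rintro _ _ ⟨t, g, h, p, q⟩
    ext <;> simp)

/-- `(b | c | d) ↦ b₀ ⨾ c₀ ∥ c₁ ⨾ b₁ ⨾ d₀ ∥ d₁ ⨾ b₂` -/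
def seqUnits (A : Obj C) :
    ((seqSplit C).conv (parUnit C) (parUnit C)).obj A ≃ SeqSplit A (triv C) (triv C) where
  toFun := Quot.lift (fun x => ⟨x.2.2.1.f₀ ≫ x.2.2.2.1.f₀, x.2.2.2.1.f₁ ≫ x.2.2.1.f₁ ≫
      x.2.2.2.2.f₀, x.2.2.2.2.f₁ ≫ x.2.2.1.f₂⟩) (by
    rintro _ _ ⟨t, g, h, p, q⟩
    ext <;> simp)
  invFun q := mk₂ (T := seqSplit C) (P := parUnit C) (Q := parUnit C) q (unitGen C) (unitGen C)
  left_inv := by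
    rintro ⟨⟨U, U', a, b, c⟩⟩
    refine mk₂_ext (T := seqSplit C) (P := parUnit C) (Q := parUnit C)
      (𝟙 _) (𝟙 _) b.hom c.hom ((parUnit C).act_id _).symm ((parUnit C).act_id _).symm
      b.eq_act c.eq_act ?_
    apply SeqSplit.ext <;> simp
  right_inv q := by ext <;> simp [mk₂]

/-- `ψ₂` rewrites `a₀ ⨾ (b₀ ⨾ □ ⨾ b₁ ⨾ □ ⨾ b₂ ⊗ c₀ ⨾ □ ⨾ c₁ ⨾ □ ⨾ c₂) ⨾ a₁` into
`a₀ ⨾ (b₀ ⊗ c₀) ⨾ (□ ⊗ □) ⨾ (b₁ ⊗ c₁) ⨾ (□ ⊗ □) ⨾ (b₂ ⊗ c₂) ⨾ a₁`. -/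
def psi₂ (A X Y Z W : Obj C)
    (x : ((parSplit C).conv ((seqSplit C).at₂ X Y) ((seqSplit C).at₂ Z W)).obj A) :
    ((seqSplit C).conv ((parSplit C).at₂ X Z) ((parSplit C).at₂ Y W)).obj A :=
  (seqPar A X Y Z W).symm (parSeq A X Y Z W x)

/-- `ψ₀` rewrites `a₀ ∥ a₁` into `a₀ ∥ 𝟙 ∥ a₁`. -/
def psi₀ (A : Obj C) (i : ParUnit A) : ((seqSplit C).conv (parUnit C) (parUnit C)).obj A :=
  (seqUnits A).symm ⟨i.f₀, 𝟙 _, i.f₁⟩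

/-- `φ₂` sends `(t | n | m)` to `t₀ ⨾ (n ⊗ m) ⨾ t₁`. -/
def phi₂ (A : Obj C) : ((parSplit C).conv (seqUnit C) (seqUnit C)).obj A → (A.l ⟶ A.r) :=
  Quot.lift (fun x => x.2.2.1.f₀ ≫ (x.2.2.2.1 ⊗ₘ x.2.2.2.2) ≫ x.2.2.1.f₁) (by
    rintro _ _ ⟨t, g, h, p, q⟩
    simp)

/-- `φ₀` sends `a₀ ∥ a₁` to `a₀ ⨾ a₁`. -/
def phi₀ (A : Obj C) (i : ParUnit A) : A.l ⟶ A.r := i.f₀ ≫ i.f₁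

theorem psi₂_iff {A X Y Z W U U' G H : Obj C} (a : ParSplit A U U') (b : SeqSplit U X Y)
    (c : SeqSplit U' Z W) (d : SeqSplit A G H) (e : ParSplit G X Z) (e' : ParSplit H Y W) :
    psi₂ A X Y Z W (mk₂ (T := parSplit C) (P := (seqSplit C).at₂ X Y)
        (Q := (seqSplit C).at₂ Z W) a b c) =
      mk₂ (T := seqSplit C) (P := (parSplit C).at₂ X Z) (Q := (parSplit C).at₂ Y W) d e e' ↔
    a.f₀ ≫ (b.f₀ ⊗ₘ c.f₀) = d.f₀ ≫ e.f₀ ∧ (b.f₁ ⊗ₘ c.f₁) = e.f₁ ≫ d.f₁ ≫ e'.f₀ ∧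
      (b.f₂ ⊗ₘ c.f₂) ≫ a.f₁ = e'.f₁ ≫ d.f₂ := by
  rw [psi₂, Equiv.symm_apply_eq]
  exact SeqSplit.ext_iff

theorem psi₀_iff {A G H : Obj C} (a : ParUnit A) (b : SeqSplit A G H) (c : ParUnit G)
    (d : ParUnit H) :
    psi₀ A a = mk₂ (T := seqSplit C) (P := parUnit C) (Q := parUnit C) b c d ↔
    a.f₀ = b.f₀ ≫ c.f₀ ∧ 𝟙 _ = c.f₁ ≫ b.f₁ ≫ d.f₀ ∧ a.f₁ = d.f₁ ≫ b.f₂ := by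
  rw [psi₀, Equiv.symm_apply_eq]
  exact SeqSplit.ext_iff

@[simp] theorem phi₂_mk {A U W : Obj C} (t : ParSplit A U W) (n : U.l ⟶ U.r) (m : W.l ⟶ W.r) :
    phi₂ A (mk₂ (T := parSplit C) (P := seqUnit C) (Q := seqUnit C) t n m) =
      t.f₀ ≫ (n ⊗ₘ m) ≫ t.f₁ := rfl

@[simp] theorem phi₀_def {A : Obj C} (i : ParUnit A) : phi₀ A i = i.f₀ ≫ i.f₁ := rfl

/-- the arrow that a threefold parallel composite amounts to determines it -/
theorem parTriR_eq_act {A X Y Z : Obj C} (x : ((parSplit C).fillR X ((parSplit C).at₂ Y Z)).obj A) :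
    x = ((parSplit C).fillR X ((parSplit C).at₂ Y Z)).act (parTriR A X Y Z x)
      (mkR (T := parSplit C) (P := (parSplit C).at₂ Y Z) (parGen X (tens Y Z)) (parGen Y Z)) := by
  refine ((parTriR A X Y Z).symm_apply_apply x).symm.trans ?_
  refine congrArg (fun t => mkR (T := parSplit C) (P := (parSplit C).at₂ Y Z) t (parGen Y Z)) ?_
  apply ParSplit.ext <;> simp

theorem psi_assoc₀ {X U U₁ U₂ U₃ A C' E G M G' Q W : C} (t : X ⟶ U ⊗ U₃) (t' : U ⟶ U₁ ⊗ U₂)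
    (s₁ : U₁ ⟶ A) (s₂ : U₂ ⟶ C') (s₃ : U₃ ⟶ E) (p : U ⟶ G) (p₁ : G ⟶ A ⊗ C')
    (q : X ⟶ Q) (q₁ : Q ⟶ G ⊗ E) (r : X ⟶ U₁ ⊗ M) (r' : M ⟶ U₂ ⊗ U₃) (v : M ⟶ G')
    (v₁ : G' ⟶ C' ⊗ E) (w : X ⟶ W) (w₁ : W ⟶ A ⊗ G')
    (e₁ : t' ≫ (s₁ ⊗ₘ s₂) = p ≫ p₁) (e₂ : t ≫ (p ⊗ₘ s₃) = q ≫ q₁)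
    (e₃ : t ≫ t' ▷ U₃ ≫ (α_ _ _ _).hom = r ≫ U₁ ◁ r') (e₄ : r' ≫ (s₂ ⊗ₘ s₃) = v ≫ v₁)
    (e₅ : r ≫ (s₁ ⊗ₘ v) = w ≫ w₁) :
    q ≫ q₁ ≫ p₁ ▷ E ≫ (α_ _ _ _).hom = w ≫ w₁ ≫ A ◁ v₁ := by
  rw [← reassoc_of% e₅, ← reassoc_of% e₂, ← id_tensorHom, ← tensorHom_id,
    tensorHom_comp_tensorHom, tensorHom_comp_tensorHom_assoc, ← e₁, ← e₄, Category.comp_id,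
    Category.comp_id]
  have h : (s₁ ⊗ₘ r' ≫ (s₂ ⊗ₘ s₃)) = U₁ ◁ r' ≫ (s₁ ⊗ₘ (s₂ ⊗ₘ s₃)) := by
    rw [← id_tensorHom, tensorHom_comp_tensorHom, Category.id_comp]
  have h' : ((t' ≫ (s₁ ⊗ₘ s₂)) ⊗ₘ s₃) = t' ▷ U₃ ≫ ((s₁ ⊗ₘ s₂) ⊗ₘ s₃) := by
    rw [← tensorHom_id, tensorHom_comp_tensorHom, Category.id_comp]
  rw [h, ← reassoc_of% e₃, h', Category.assoc, associator_naturality]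

theorem psi_assoc₁ {X U U₁ U₂ U₃ A C' E G M G' Q W : C} (t : U ⊗ U₃ ⟶ X) (t' : U₁ ⊗ U₂ ⟶ U)
    (s₁ : A ⟶ U₁) (s₂ : C' ⟶ U₂) (s₃ : E ⟶ U₃) (p : G ⟶ U) (p₁ : A ⊗ C' ⟶ G)
    (q : Q ⟶ X) (q₁ : G ⊗ E ⟶ Q) (r : U₁ ⊗ M ⟶ X) (r' : U₂ ⊗ U₃ ⟶ M) (v : G' ⟶ M)
    (v₁ : C' ⊗ E ⟶ G') (w : W ⟶ X) (w₁ : A ⊗ G' ⟶ W)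
    (e₁ : (s₁ ⊗ₘ s₂) ≫ t' = p₁ ≫ p) (e₂ : (p ⊗ₘ s₃) ≫ t = q₁ ≫ q)
    (e₃ : (α_ _ _ _).inv ≫ t' ▷ U₃ ≫ t = U₁ ◁ r' ≫ r) (e₄ : (s₂ ⊗ₘ s₃) ≫ r' = v₁ ≫ v)
    (e₅ : (s₁ ⊗ₘ v) ≫ r = w₁ ≫ w) :
    ((α_ _ _ _).inv ≫ p₁ ▷ E ≫ q₁) ≫ q = (A ◁ v₁ ≫ w₁) ≫ w := by
  rw [Category.assoc, Category.assoc, Category.assoc, ← e₅, ← e₂, ← id_tensorHom, ← tensorHom_id,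
    tensorHom_comp_tensorHom_assoc, tensorHom_comp_tensorHom_assoc, ← e₁, ← e₄, Category.id_comp,
    Category.id_comp]
  have h : (s₁ ⊗ₘ ((s₂ ⊗ₘ s₃) ≫ r')) = (s₁ ⊗ₘ (s₂ ⊗ₘ s₃)) ≫ U₁ ◁ r' := by
    rw [← id_tensorHom, tensorHom_comp_tensorHom, Category.comp_id]
  have h' : (((s₁ ⊗ₘ s₂) ≫ t') ⊗ₘ s₃) = ((s₁ ⊗ₘ s₂) ⊗ₘ s₃) ≫ t' ▷ U₃ := by
    rw [← tensorHom_id, tensorHom_comp_tensorHom, Category.comp_id]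
  rw [h, Category.assoc, ← e₃, h', Category.assoc, associator_inv_naturality_assoc]

theorem psi_assoc₂ {A B D E F K U U' G H M M' L' L'' : C}
    (s₁ : A ⟶ B) (s₂ : D ⟶ E) (s₃ : F ⟶ K) (p : G ⟶ H) (p₁ : A ⊗ D ⟶ G) (p₂ : H ⟶ B ⊗ E)
    (q : U ⟶ U') (q₁ : G ⊗ F ⟶ U) (q₂ : U' ⟶ H ⊗ K) (v : M ⟶ M') (v₁ : D ⊗ F ⟶ M)
    (v₂ : M' ⟶ E ⊗ K) (w : L' ⟶ L'') (w₁ : A ⊗ M ⟶ L') (w₂ : L'' ⟶ B ⊗ M')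
    (e₁ : (s₁ ⊗ₘ s₂) = p₁ ≫ p ≫ p₂) (e₂ : (p ⊗ₘ s₃) = q₁ ≫ q ≫ q₂)
    (e₄ : (s₂ ⊗ₘ s₃) = v₁ ≫ v ≫ v₂) (e₅ : (s₁ ⊗ₘ v) = w₁ ≫ w ≫ w₂) :
    ((α_ _ _ _).inv ≫ p₁ ▷ F ≫ q₁) ≫ q ≫ q₂ ≫ p₂ ▷ K ≫ (α_ _ _ _).hom =
      (A ◁ v₁ ≫ w₁) ≫ w ≫ w₂ ≫ B ◁ v₂ := by
  have h : (A ◁ v₁ ≫ w₁) ≫ w ≫ w₂ ≫ B ◁ v₂ = s₁ ⊗ₘ (s₂ ⊗ₘ s₃) := by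
    rw [Category.assoc, ← reassoc_of% e₅, e₄, ← id_tensorHom, ← id_tensorHom,
      tensorHom_comp_tensorHom, tensorHom_comp_tensorHom, Category.comp_id, Category.id_comp]
  have h' : ((s₁ ⊗ₘ s₂) ⊗ₘ s₃) = p₁ ▷ F ≫ (q₁ ≫ q ≫ q₂) ≫ p₂ ▷ K := by
    rw [← e₂, e₁, ← tensorHom_id, ← tensorHom_id,
      tensorHom_comp_tensorHom, tensorHom_comp_tensorHom, Category.comp_id, Category.id_comp]
  rw [h, ← cancel_epi (α_ A D F).hom, ← associator_naturality, h']
  simp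

/-- The produoidal structure of the splice. -/
@[reducible]
def str (C : Type u) [SmallCategory C] [MonoidalCategory C] : Produoidal (Obj C) where
  par := par C
  seq := seq C
  psi₂ := psi₂
  psi₀ := psi₀
  phi₂ := phi₂
  phi₀ := phi₀
  psi₂_natural f g h k l a b c d e e' x := by
    obtain ⟨x₀, x₁, x₂⟩ := (psi₂_iff _ _ _ _ _ _).1 x
    refine (psi₂_iff _ _ _ _ _ _).2 ⟨?_, ?_, ?_⟩
    · simp [← reassoc_of% x₀]
    · simp only [Category.id_comp, Category.comp_id, Category.assoc, id_f₀, id_f₁,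
        ← tensorHom_comp_tensorHom, x₁]
    · simp [← reassoc_of% x₂]
  psi₀_natural f i := by
    refine congrArg (fun t => mk₂ (T := seqSplit C) (P := parUnit C) (Q := parUnit C) t
      (unitGen C) (unitGen C)) ?_
    apply SeqSplit.ext <;> simp
  phi₂_natural f x := by
    obtain ⟨⟨U, W, t, n, m⟩⟩ := x
    simp [phi₂, conv, Quot.map]
  phi₀_natural f i := by simp
  psi₂_assoc_par t t' s₁ s₂ s₃ _ _ _ _ p p₁ p₂ q q₁ q₂ _ _ _ _ _ r r' v v₁ v₂ w w₁ w₂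
      e₁ e₂ e₃ e₄ e₅ := by
    obtain ⟨e₁₀, e₁₁, e₁₂⟩ := (psi₂_iff _ _ _ _ _ _).1 e₁
    obtain ⟨e₂₀, e₂₁, e₂₂⟩ := (psi₂_iff _ _ _ _ _ _).1 e₂
    obtain ⟨e₃₀, e₃₁⟩ := (parAssoc_iff _ _ _ _).1 e₃
    obtain ⟨e₄₀, e₄₁, e₄₂⟩ := (psi₂_iff _ _ _ _ _ _).1 e₄
    obtain ⟨e₅₀, e₅₁, e₅₂⟩ := (psi₂_iff _ _ _ _ _ _).1 e₅
    refine mk₂_ext _ _ _ _ (parTriR_eq_act _) (parTriR_eq_act _) (parTriR_eq_act _)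
      (parTriR_eq_act _) ?_
    rw [Equiv.trans_apply, Equiv.trans_apply, Equiv.apply_symm_apply, Equiv.apply_symm_apply]
    apply SeqSplit.ext
    · simp only [id_f₀, Category.id_comp]
      exact psi_assoc₀ _ _ _ _ _ _ _ _ _ _ _ _ _ _ _ e₁₀ e₂₀ e₃₀ e₄₀ e₅₀
    · exact psi_assoc₂ _ _ _ _ _ _ _ _ _ _ _ _ _ _ _ e₁₁ e₂₁ e₄₁ e₅₁
    · simp only [id_f₁, Category.comp_id]
      exact psi_assoc₁ _ _ _ _ _ _ _ _ _ _ _ _ _ _ _ e₁₂ e₂₂ e₃₁ e₄₂ e₅₂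
  psi₂_assoc_seq t s s' z z' _ _ _ _ _ p p₁ p₂ q q₁ q₂ r r' _ _ _ _ _ _ m m' o o' v v₁ v₂ w w₁ w₂
      e₁ e₂ e₃ e₄ e₅ e₆ e₇ := by
    obtain ⟨e₁₀, e₁₁, e₁₂⟩ := (psi₂_iff _ _ _ _ _ _).1 e₁
    obtain ⟨e₂₀, e₂₁, e₂₂⟩ := (psi₂_iff _ _ _ _ _ _).1 e₂
    obtain ⟨e₃₀, e₃₁, e₃₂, e₃₃⟩ := (seqAssoc_iff _ _ _ _).1 e₃
    obtain ⟨e₄₀, e₄₁, e₄₂, e₄₃⟩ := (seqAssoc_iff _ _ _ _).1 e₄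
    obtain ⟨e₅₀, e₅₁, e₅₂, e₅₃⟩ := (seqAssoc_iff _ _ _ _).1 e₅
    obtain ⟨e₆₀, e₆₁, e₆₂⟩ := (psi₂_iff _ _ _ _ _ _).1 e₆
    obtain ⟨e₇₀, e₇₁, e₇₂⟩ := (psi₂_iff _ _ _ _ _ _).1 e₇
    refine seqConv_ext _ _ _ _ _ _ (ParSplit.eq_act _) (ParSplit.eq_act _) (ParSplit.eq_act _)
      (ParSplit.eq_act _) (ParSplit.eq_act _) (ParSplit.eq_act _) ?_ ?_ ?_ ?_
    · change r.f₀ ≫ q₁.f₀ = v.f₀ ≫ v₁.f₀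
      rw [← e₆₀, ← e₄₀, ← e₅₀, ← e₃₀, Category.assoc, ← e₂₀, ← tensorHom_comp_tensorHom,
        ← reassoc_of% e₁₀]
    · change q₁.f₁ ≫ r.f₁ ≫ r'.f₀ ≫ q₂.f₀ = v₁.f₁ ≫ v.f₁ ≫ w.f₀ ≫ w₁.f₀
      rw [← reassoc_of% e₃₁, ← e₂₁, e₄₁, e₅₁, ← tensorHom_comp_tensorHom, e₆₁, ← e₇₀]
      simp
    · change q₂.f₁ ≫ r'.f₁ ≫ p₂.f₀ = w₁.f₁ ≫ w.f₁ ≫ w₂.f₀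
      rw [← e₃₂, Category.assoc, ← reassoc_of% e₂₂, ← e₁₁, tensorHom_comp_tensorHom, e₄₂, e₅₂, e₇₁]
    · change p₂.f₁ ≫ r'.f₂ ≫ r.f₂ = w₂.f₁ ≫ w.f₂ ≫ v.f₂
      rw [← e₃₃, ← e₁₂, e₄₃, e₅₃, ← tensorHom_comp_tensorHom, Category.assoc, e₆₂,
        reassoc_of% e₇₂]
  psi₂_lam_par t i s _ _ _ _ p j j' q q₁ q₂ e₁ e₂ := by
    obtain ⟨e₁₀, e₁₁, e₁₂⟩ := (psi₀_iff _ _ _ _).1 e₁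
    obtain ⟨e₂₀, e₂₁, e₂₂⟩ := (psi₂_iff _ _ _ _ _ _).1 e₂
    apply SeqSplit.ext
    · simp only [parLam_mk, id_f₀, Category.comp_id, Category.id_comp, Category.assoc,
        ← reassoc_of% e₂₀, e₁₀]
      simp [MonoidalCategory.tensorHom_def', whisker_exchange_assoc]
    · simp only [parLam_mk, id_f₀, id_f₁, Category.comp_id, Category.id_comp, Category.assoc,
        ← reassoc_of% e₂₁]
      rw [← tensorHom_id, ← tensorHom_id, tensorHom_comp_tensorHom_assoc,
        tensorHom_comp_tensorHom_assoc, Category.assoc, ← e₁₁]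
      simp
    · simp only [parLam_mk, id_f₁, Category.comp_id, Category.id_comp, Category.assoc,
        ← e₂₂, e₁₂]
      simp [MonoidalCategory.tensorHom_def, ← whisker_exchange_assoc]
  psi₂_rho_par t s i _ _ _ _ p j j' q q₁ q₂ e₁ e₂ := by
    obtain ⟨e₁₀, e₁₁, e₁₂⟩ := (psi₀_iff _ _ _ _).1 e₁
    obtain ⟨e₂₀, e₂₁, e₂₂⟩ := (psi₂_iff _ _ _ _ _ _).1 e₂
    apply SeqSplit.ext
    · simp only [parRho_mk, id_f₀, Category.comp_id, Category.id_comp, Category.assoc,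
        ← reassoc_of% e₂₀, e₁₀]
      simp [MonoidalCategory.tensorHom_def, ← whisker_exchange_assoc]
    · simp only [parRho_mk, id_f₀, id_f₁, Category.comp_id, Category.id_comp, Category.assoc,
        ← reassoc_of% e₂₁]
      rw [← id_tensorHom, ← id_tensorHom, tensorHom_comp_tensorHom_assoc,
        tensorHom_comp_tensorHom_assoc]
      simp [← e₁₁]
    · simp only [parRho_mk, id_f₁, Category.comp_id, Category.id_comp, Category.assoc,
        ← e₂₂, e₁₂]
      simp [MonoidalCategory.tensorHom_def', whisker_exchange_assoc]
  psi₂_lam_seq t s n s' n' _ _ q q₁ q₂ e := by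
    obtain ⟨e₀, e₁, e₂⟩ := (psi₂_iff _ _ _ _ _ _).1 e
    apply ParSplit.ext
    · simp only [seqLam_mk, phi₂_mk, id_f₀, Category.id_comp, Category.assoc, id_tensorHom_id,
        Category.comp_id, ← reassoc_of% e₀, ← tensorHom_comp_tensorHom, e₁]
    · simp [e₂]
  psi₂_rho_seq t s n s' n' _ _ q q₁ q₂ e := by
    obtain ⟨e₀, e₁, e₂⟩ := (psi₂_iff _ _ _ _ _ _).1 e
    apply ParSplit.ext
    · simp [e₀]
    · simp only [seqRho_mk, phi₂_mk, id_f₁, Category.id_comp, Category.assoc, id_tensorHom_id,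
        Category.comp_id, ← tensorHom_comp_tensorHom, e₁, e₂]
  phi₂_assoc t t' n₁ n₂ n₃ r r' e := by
    obtain ⟨e₀, e₁⟩ := (parAssoc_iff _ _ _ _).1 e
    simp only [phi₂_mk]
    have h₁ : ((t'.f₀ ≫ (n₁ ⊗ₘ n₂) ≫ t'.f₁) ⊗ₘ n₃) =
        t'.f₀ ▷ _ ≫ ((n₁ ⊗ₘ n₂) ⊗ₘ n₃) ≫ t'.f₁ ▷ _ := by
      simp only [← tensorHom_id, tensorHom_comp_tensorHom, Category.id_comp, Category.comp_id]
    have h₂ : (n₁ ⊗ₘ (r'.f₀ ≫ (n₂ ⊗ₘ n₃) ≫ r'.f₁)) =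
        _ ◁ r'.f₀ ≫ (n₁ ⊗ₘ (n₂ ⊗ₘ n₃)) ≫ _ ◁ r'.f₁ := by
      simp only [← id_tensorHom, tensorHom_comp_tensorHom, Category.id_comp, Category.comp_id]
    rw [h₁, h₂]
    simp only [Category.assoc, ← reassoc_of% e₀, ← e₁, ← associator_naturality_assoc]
    simp
  psi₀_coassoc i s i₁ i₂ _ _ _ _ _ p j j' r r' q k k' e₁ e₂ e₃ e₄ := by
    obtain ⟨e₁₀, e₁₁, e₁₂⟩ := (psi₀_iff _ _ _ _).1 e₁
    obtain ⟨e₂₀, e₂₁, e₂₂⟩ := (psi₀_iff _ _ _ _).1 e₂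
    obtain ⟨e₃₀, e₃₁, e₃₂, e₃₃⟩ := (seqAssoc_iff _ _ _ _).1 e₃
    obtain ⟨e₄₀, e₄₁, e₄₂⟩ := (psi₀_iff _ _ _ _).1 e₄
    refine seqConv_ext _ _ _ _ _ _ (ParUnit.eq_act _) (ParUnit.eq_act _) (ParUnit.eq_act _)
      (ParUnit.eq_act _) (ParUnit.eq_act _) (ParUnit.eq_act _) ?_ ?_ ?_ ?_
    · change r.f₀ ≫ j.f₀ = s.f₀ ≫ i₁.f₀
      rw [← e₃₀, e₂₀, Category.assoc]
    · change j.f₁ ≫ r.f₁ ≫ r'.f₀ ≫ j'.f₀ = i₁.f₁ ≫ s.f₁ ≫ q.f₀ ≫ k.f₀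
      rw [← reassoc_of% e₃₁, ← e₂₁, ← e₄₀, ← e₁₁]
    · change j'.f₁ ≫ r'.f₁ ≫ i₂.f₀ = k.f₁ ≫ q.f₁ ≫ k'.f₀
      rw [← e₃₂, Category.assoc, ← reassoc_of% e₂₂, ← e₁₁, e₄₁]
    · change i₂.f₁ ≫ r'.f₂ ≫ r.f₂ = k'.f₁ ≫ q.f₂ ≫ s.f₂
      rw [← e₃₃, e₄₂, Category.assoc]
  phi₂_phi₀_right t n i := by
    simp [MonoidalCategory.tensorHom_def']
    rw [whisker_exchange_assoc, MonoidalCategory.whiskerRight_id]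
    simp
  phi₂_phi₀_left t i n := by
    simp [MonoidalCategory.tensorHom_def']
    rw [whisker_exchange_assoc, id_whiskerLeft]
    simp
  psi₀_phi₀_right i s i₁ i₂ e := by
    obtain ⟨e₀, e₁, e₂⟩ := (psi₀_iff _ _ _ _).1 e
    apply ParUnit.ext
    · simp [e₀]
    · simp only [seqRho_mk, phi₀_def, Category.assoc, ← e₂, ← reassoc_of% e₁]
  psi₀_phi₀_left i s i₁ i₂ e := by
    obtain ⟨e₀, e₁, e₂⟩ := (psi₀_iff _ _ _ _).1 e
    apply ParUnit.ext
    · simp only [seqLam_mk, phi₀_def, Category.assoc, e₀, ← e₁, Category.comp_id]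
    · simp [e₂]

end Splice

namespace StrictMonoidalFunctor

variable {C D : MonoCat.{u}} (F : StrictMonoidalFunctor C D)

theorem map_whiskerRight {X Y : C.carrier} (f : X ⟶ Y) (Z : C.carrier) :
    F.fn.map (f ▷ Z) = eqToHom (F.obj_tensor X Z) ≫ F.fn.map f ▷ F.fn.obj Z ≫
      eqToHom (F.obj_tensor Y Z).symm := by
  rw [← tensorHom_id, F.map_tensor, F.fn.map_id, tensorHom_id]

theorem map_whiskerLeft (Z : C.carrier) {X Y : C.carrier} (f : X ⟶ Y) :
    F.fn.map (Z ◁ f) = eqToHom (F.obj_tensor Z X) ≫ F.fn.obj Z ◁ F.fn.map f ≫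
      eqToHom (F.obj_tensor Z Y).symm := by
  rw [← id_tensorHom, F.map_tensor, F.fn.map_id, id_tensorHom]

theorem map_associator_inv (X Y Z : C.carrier) :
    F.fn.map (α_ X Y Z).inv = eqToHom (by rw [F.obj_tensor, F.obj_tensor]) ≫
      (α_ (F.fn.obj X) (F.fn.obj Y) (F.fn.obj Z)).inv ≫
        eqToHom (by rw [F.obj_tensor, F.obj_tensor]) := by
  rw [← cancel_epi (F.fn.map (α_ X Y Z).hom), ← F.fn.map_comp, Iso.hom_inv_id, F.map_associator]
  simp

theorem map_leftUnitor_inv (X : C.carrier) :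
    F.fn.map (λ_ X).inv = (λ_ (F.fn.obj X)).inv ≫ eqToHom (by rw [F.obj_tensor, F.obj_unit]) := by
  rw [← cancel_epi (F.fn.map (λ_ X).hom), ← F.fn.map_comp, Iso.hom_inv_id, F.map_leftUnitor]
  simp

theorem map_rightUnitor_inv (X : C.carrier) :
    F.fn.map (ρ_ X).inv = (ρ_ (F.fn.obj X)).inv ≫ eqToHom (by rw [F.obj_tensor, F.obj_unit]) := by
  rw [← cancel_epi (F.fn.map (ρ_ X).hom), ← F.fn.map_comp, Iso.hom_inv_id, F.map_rightUnitor]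
  simp

theorem comp_obj_tensor₀ {E : MonoCat.{u}} (G : StrictMonoidalFunctor D E) {X Y Z : C.carrier}
    (f : Z ⟶ X ⊗ Y) : G.fn.map (F.fn.map f) ≫ eqToHom ((F.comp G).obj_tensor X Y) =
      G.fn.map (F.fn.map f ≫ eqToHom (F.obj_tensor X Y)) ≫ eqToHom (G.obj_tensor _ _) := by
  rw [G.fn.map_comp, eqToHom_map, Category.assoc, eqToHom_trans]
  rfl

theorem comp_obj_tensor₁ {E : MonoCat.{u}} (G : StrictMonoidalFunctor D E) {X Y Z : C.carrier}
    (f : X ⊗ Y ⟶ Z) : eqToHom ((F.comp G).obj_tensor X Y).symm ≫ G.fn.map (F.fn.map f) =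
      eqToHom (G.obj_tensor _ _).symm ≫
        G.fn.map (eqToHom (F.obj_tensor X Y).symm ≫ F.fn.map f) := by
  rw [G.fn.map_comp, eqToHom_map, eqToHom_trans_assoc]
  rfl

end StrictMonoidalFunctor

/-- The produoidal category of spliced monoidal arrows. -/
@[reducible]
def splice (C : MonoCat.{u}) : PDuo.{u} where
  carrier := Splice.Obj C.carrier
  str := Splice.str C.carrier

open Splice in
/-- The action of a strict monoidal functor on spliced monoidal arrows. -/
def spliceMap {C D : MonoCat.{u}} (F : StrictMonoidalFunctor C D) :
    PDuoFunctor (splice C) (splice D) where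
  fn :=
    { obj := fun A => ⟨F.fn.obj A.l, F.fn.obj A.r⟩
      map := fun f => ⟨F.fn.map f.f₀, F.fn.map f.f₁⟩
      map_id := fun A => by apply Splice.hom_ext <;> simp
      map_comp := fun f g => by apply Splice.hom_ext <;> simp }
  mapPar t := ⟨F.fn.map t.f₀ ≫ eqToHom (F.obj_tensor _ _),
    eqToHom (F.obj_tensor _ _).symm ≫ F.fn.map t.f₁⟩
  mapParUnit i := ⟨F.fn.map i.f₀ ≫ eqToHom F.obj_unit, eqToHom F.obj_unit.symm ≫ F.fn.map i.f₁⟩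
  mapSeq s := ⟨F.fn.map s.f₀, F.fn.map s.f₁, F.fn.map s.f₂⟩
  mapSeqUnit n := F.fn.map n
  mapPar_natural f t g h := by apply ParSplit.ext <;> simp [F.map_tensor]
  mapParUnit_natural f i := by apply ParUnit.ext <;> simp
  mapSeq_natural f s g h := by apply SeqSplit.ext <;> simp
  mapSeqUnit_natural f n := by simp
  par_assoc a b c d e := by
    obtain ⟨e₀, e₁⟩ := (parAssoc_iff _ _ _ _).1 e
    refine (parAssoc_iff _ _ _ _).2 ⟨?_, ?_⟩
    · have := congrArg F.fn.map e₀
      simp [F.map_whiskerLeft, F.map_whiskerRight, F.map_associator] at this ⊢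
      have := this =≫ eqToHom
        ((F.obj_tensor _ _).trans (congrArg (F.fn.obj _ ⊗ ·) (F.obj_tensor _ _)))
      simpa using this
    · have := congrArg F.fn.map e₁
      simp [F.map_whiskerLeft, F.map_whiskerRight, F.map_associator_inv] at this ⊢
      have := eqToHom
        ((F.obj_tensor _ _).trans (congrArg (F.fn.obj _ ⊗ ·) (F.obj_tensor _ _))).symm ≫= this
      simpa using this
  par_lam a i := by
    apply Splice.hom_ext
    · simp [F.map_whiskerRight, F.map_leftUnitor]
    · simp [F.map_whiskerRight, F.map_leftUnitor_inv]
  par_rho a i := by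
    apply Splice.hom_ext
    · simp [F.map_whiskerLeft, F.map_rightUnitor]
    · simp [F.map_whiskerLeft, F.map_rightUnitor_inv]
  seq_assoc a b c d e := by
    obtain ⟨e₀, e₁, e₂, e₃⟩ := (seqAssoc_iff _ _ _ _).1 e
    refine (seqAssoc_iff _ _ _ _).2 ⟨?_, ?_, ?_, ?_⟩
    · simpa using congrArg F.fn.map e₀
    · simpa using congrArg F.fn.map e₁
    · simpa using congrArg F.fn.map e₂
    · simpa using congrArg F.fn.map e₃
  seq_lam a n := by apply Splice.hom_ext <;> simp
  seq_rho a n := by apply Splice.hom_ext <;> simp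
  psi₂ a b c d e e' h := by
    obtain ⟨e₀, e₁, e₂⟩ := (psi₂_iff _ _ _ _ _ _).1 h
    refine (psi₂_iff _ _ _ _ _ _).2 ⟨?_, ?_, ?_⟩
    · have := congrArg F.fn.map e₀
      simp [F.map_tensor] at this ⊢
      simp [← reassoc_of% this]
    · have := congrArg F.fn.map e₁
      simp [F.map_tensor] at this ⊢
      simp [← reassoc_of% this]
    · have := congrArg F.fn.map e₂
      simp [F.map_tensor] at this ⊢
      simp [← this]
  psi₀ i s j k h := by
    obtain ⟨e₀, e₁, e₂⟩ := (psi₀_iff _ _ _ _).1 h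
    refine (psi₀_iff _ _ _ _).2 ⟨?_, ?_, ?_⟩
    · simp [e₀]
    · have := congrArg F.fn.map e₁
      simp at this ⊢
      simp [← reassoc_of% this]
    · simp [e₂]
  phi₂ t n m := by simp [F.map_tensor]
  phi₀ i := by simp

/-- The functor sending a monoidal category to its produoidal category of spliced monoidal
arrows. -/
def spliceFunctor : MonoCat.{u} ⥤ PDuo.{u} where
  obj := splice
  map F := spliceMap F
  map_id C := by
    refine PDuoFunctor.ext rfl (heq_of_eq ?_) (heq_of_eq ?_) (heq_of_eq ?_) (heq_of_eq ?_)
    · funext A X Y t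
      exact Splice.ParSplit.ext (Category.comp_id _) (Category.id_comp _)
    · funext A i
      exact Splice.ParUnit.ext (Category.comp_id _) (Category.id_comp _)
    · rfl
    · rfl
  map_comp {C D E} F G := by
    refine PDuoFunctor.ext rfl (heq_of_eq ?_) (heq_of_eq ?_) (heq_of_eq ?_) (heq_of_eq ?_)
    · funext A X Y t
      apply Splice.ParSplit.ext
      · exact StrictMonoidalFunctor.comp_obj_tensor₀ F G t.f₀
      · exact StrictMonoidalFunctor.comp_obj_tensor₁ F G t.f₁
    · funext A i
      apply Splice.ParUnit.ext
      · change G.fn.map (F.fn.map i.f₀) ≫ eqToHom _ =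
          G.fn.map (F.fn.map i.f₀ ≫ eqToHom _) ≫ eqToHom _
        simp [eqToHom_map]
      · change eqToHom _ ≫ G.fn.map (F.fn.map i.f₁) =
          eqToHom _ ≫ G.fn.map (eqToHom _ ≫ F.fn.map i.f₁)
        simp [eqToHom_map]
    · rfl
    · rfl

/-! ## Monoidal contour -/

/-- The objects of the contour: formal tensors of left-handed and right-handed objects. -/
inductive ContourObj (B : PDuo.{u}) : Type u
  | L (X : B.carrier)
  | R (X : B.carrier)
  | unit
  | tensor (X Y : ContourObj B)

open ContourObj in
/-- Formal composites and tensors of identities, coherence maps and the generators of the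
contour. -/
inductive ContourHom (B : PDuo.{u}) : ContourObj B → ContourObj B → Type u
  | ident (X : ContourObj B) : ContourHom B X X
  | comp {X Y Z : ContourObj B} (f : ContourHom B X Y) (g : ContourHom B Y Z) : ContourHom B X Z
  | tensor {X Y X' Y' : ContourObj B} (f : ContourHom B X Y) (g : ContourHom B X' Y') :
      ContourHom B (X.tensor X') (Y.tensor Y')
  | assoc_hom (X Y Z : ContourObj B) : ContourHom B ((X.tensor Y).tensor Z) (X.tensor (Y.tensor Z))
  | assoc_inv (X Y Z : ContourObj B) : ContourHom B (X.tensor (Y.tensor Z)) ((X.tensor Y).tensor Z)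
  | lam_hom (X : ContourObj B) : ContourHom B (unit.tensor X) X
  | lam_inv (X : ContourObj B) : ContourHom B X (unit.tensor X)
  | rho_hom (X : ContourObj B) : ContourHom B (X.tensor unit) X
  | rho_inv (X : ContourObj B) : ContourHom B X (X.tensor unit)
  /-- the pair `a₀, a₁` of a morphism `a : A ⟶ X` -/
  | hom₀ {A X : B.carrier} (a : A ⟶ X) : ContourHom B (L A) (L X)
  | hom₁ {A X : B.carrier} (a : A ⟶ X) : ContourHom B (R X) (R A)
  /-- the morphism `a₀` of a sequential unit -/
  | seqUnit₀ {A : B.carrier} (a : B.SeqUnit A) : ContourHom B (L A) (R A)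
  /-- the pair `a₀, a₁` of a parallel unit -/
  | parUnit₀ {A : B.carrier} (a : B.ParUnit A) : ContourHom B (L A) unit
  | parUnit₁ {A : B.carrier} (a : B.ParUnit A) : ContourHom B unit (R A)
  /-- the triple `a₀, a₁, a₂` of a sequential split -/
  | seq₀ {A X Y : B.carrier} (a : B.SeqSplit A X Y) : ContourHom B (L A) (L X)
  | seq₁ {A X Y : B.carrier} (a : B.SeqSplit A X Y) : ContourHom B (R X) (L Y)
  | seq₂ {A X Y : B.carrier} (a : B.SeqSplit A X Y) : ContourHom B (R Y) (R A)
  /-- the pair `a₀, a₁` of a parallel split -/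
  | par₀ {A X Y : B.carrier} (a : B.ParSplit A X Y) : ContourHom B (L A) ((L X).tensor (L Y))
  | par₁ {A X Y : B.carrier} (a : B.ParSplit A X Y) : ContourHom B ((R X).tensor (R Y)) (R A)

open ContourObj ContourHom in
/-- The congruence generated by the laws of monoidal categories and the equations of the
contour. -/
inductive ContourRel (B : PDuo.{u}) :
    ∀ {X Y : ContourObj B}, ContourHom B X Y → ContourHom B X Y → Prop
  | refl {X Y : ContourObj B} (f : ContourHom B X Y) : ContourRel B f f
  | symm {X Y : ContourObj B} {f g : ContourHom B X Y} : ContourRel B f g → ContourRel B g f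
  | trans {X Y : ContourObj B} {f g h : ContourHom B X Y} :
      ContourRel B f g → ContourRel B g h → ContourRel B f h
  | comp {X Y Z : ContourObj B} {f f' : ContourHom B X Y} {g g' : ContourHom B Y Z} :
      ContourRel B f f' → ContourRel B g g' → ContourRel B (f.comp g) (f'.comp g')
  | tensor {X Y X' Y' : ContourObj B} {f f' : ContourHom B X Y} {g g' : ContourHom B X' Y'} :
      ContourRel B f f' → ContourRel B g g' → ContourRel B (f.tensor g) (f'.tensor g')
  -- the laws of monoidal categories
  | id_comp {X Y : ContourObj B} (f : ContourHom B X Y) : ContourRel B ((ident X).comp f) f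
  | comp_id {X Y : ContourObj B} (f : ContourHom B X Y) : ContourRel B (f.comp (ident Y)) f
  | comp_assoc {X Y Z W : ContourObj B} (f : ContourHom B X Y) (g : ContourHom B Y Z) (h : ContourHom B Z W) :
      ContourRel B ((f.comp g).comp h) (f.comp (g.comp h))
  | id_tensor_id (X Y : ContourObj B) : ContourRel B ((ident X).tensor (ident Y)) (ident (X.tensor Y))
  | tensor_comp {X Y Z X' Y' Z' : ContourObj B} (f : ContourHom B X Y) (f' : ContourHom B X' Y')
      (g : ContourHom B Y Z) (g' : ContourHom B Y' Z') :
      ContourRel B ((f.tensor f').comp (g.tensor g')) ((f.comp g).tensor (f'.comp g'))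
  | assoc_hom_inv (X Y Z : ContourObj B) :
      ContourRel B ((assoc_hom X Y Z).comp (assoc_inv X Y Z)) (ident _)
  | assoc_inv_hom (X Y Z : ContourObj B) :
      ContourRel B ((assoc_inv X Y Z).comp (assoc_hom X Y Z)) (ident _)
  | lam_hom_inv (X : ContourObj B) : ContourRel B ((lam_hom X).comp (lam_inv X)) (ident _)
  | lam_inv_hom (X : ContourObj B) : ContourRel B ((lam_inv X).comp (lam_hom X)) (ident _)
  | rho_hom_inv (X : ContourObj B) : ContourRel B ((rho_hom X).comp (rho_inv X)) (ident _)
  | rho_inv_hom (X : ContourObj B) : ContourRel B ((rho_inv X).comp (rho_hom X)) (ident _)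
  | assoc_naturality {X Y Z X' Y' Z' : ContourObj B} (f : ContourHom B X X') (g : ContourHom B Y Y')
      (h : ContourHom B Z Z') :
      ContourRel B (((f.tensor g).tensor h).comp (assoc_hom X' Y' Z'))
        ((assoc_hom X Y Z).comp (f.tensor (g.tensor h)))
  | lam_naturality {X Y : ContourObj B} (f : ContourHom B X Y) :
      ContourRel B (((ident unit).tensor f).comp (lam_hom Y)) ((lam_hom X).comp f)
  | rho_naturality {X Y : ContourObj B} (f : ContourHom B X Y) :
      ContourRel B ((f.tensor (ident unit)).comp (rho_hom Y)) ((rho_hom X).comp f)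
  | pentagon (X Y Z W : ContourObj B) :
      ContourRel B
        (((assoc_hom X Y Z).tensor (ident W)).comp
          ((assoc_hom X (Y.tensor Z) W).comp ((ident X).tensor (assoc_hom Y Z W))))
        ((assoc_hom (X.tensor Y) Z W).comp (assoc_hom X Y (Z.tensor W)))
  | triangle (X Y : ContourObj B) :
      ContourRel B ((assoc_hom X unit Y).comp ((ident X).tensor (lam_hom Y)))
        ((rho_hom X).tensor (ident Y))
  -- functoriality of the generators
  | hom₀_id (A : B.carrier) : ContourRel B (hom₀ (𝟙 A)) (ident (L A))
  | hom₁_id (A : B.carrier) : ContourRel B (hom₁ (𝟙 A)) (ident (R A))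
  | hom₀_comp {A X Y : B.carrier} (f : A ⟶ X) (g : X ⟶ Y) :
      ContourRel B (hom₀ (f ≫ g)) ((hom₀ f).comp (hom₀ g))
  | hom₁_comp {A X Y : B.carrier} (f : A ⟶ X) (g : X ⟶ Y) :
      ContourRel B (hom₁ (f ≫ g)) ((hom₁ g).comp (hom₁ f))
  | seqUnit₀_act {A' A : B.carrier} (f : A' ⟶ A) (a : B.SeqUnit A) :
      ContourRel B (seqUnit₀ (B.str.seq.unit.act f a))
        ((hom₀ f).comp ((seqUnit₀ a).comp (hom₁ f)))
  | parUnit₀_act {A' A : B.carrier} (f : A' ⟶ A) (a : B.ParUnit A) :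
      ContourRel B (parUnit₀ (B.str.par.unit.act f a)) ((hom₀ f).comp (parUnit₀ a))
  | parUnit₁_act {A' A : B.carrier} (f : A' ⟶ A) (a : B.ParUnit A) :
      ContourRel B (parUnit₁ (B.str.par.unit.act f a)) ((parUnit₁ a).comp (hom₁ f))
  | seq₀_act {A' A X X' Y Y' : B.carrier} (f : A' ⟶ A) (a : B.SeqSplit A X Y) (g : X ⟶ X')
      (h : Y ⟶ Y') :
      ContourRel B (seq₀ (B.str.seq.split.act f a g h)) ((hom₀ f).comp ((seq₀ a).comp (hom₀ g)))
  | seq₁_act {A' A X X' Y Y' : B.carrier} (f : A' ⟶ A) (a : B.SeqSplit A X Y) (g : X ⟶ X')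
      (h : Y ⟶ Y') :
      ContourRel B (seq₁ (B.str.seq.split.act f a g h)) ((hom₁ g).comp ((seq₁ a).comp (hom₀ h)))
  | seq₂_act {A' A X X' Y Y' : B.carrier} (f : A' ⟶ A) (a : B.SeqSplit A X Y) (g : X ⟶ X')
      (h : Y ⟶ Y') :
      ContourRel B (seq₂ (B.str.seq.split.act f a g h)) ((hom₁ h).comp ((seq₂ a).comp (hom₁ f)))
  | par₀_act {A' A X X' Y Y' : B.carrier} (f : A' ⟶ A) (a : B.ParSplit A X Y) (g : X ⟶ X')
      (h : Y ⟶ Y') :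
      ContourRel B (par₀ (B.str.par.split.act f a g h))
        ((hom₀ f).comp ((par₀ a).comp ((hom₀ g).tensor (hom₀ h))))
  | par₁_act {A' A X X' Y Y' : B.carrier} (f : A' ⟶ A) (a : B.ParSplit A X Y) (g : X ⟶ X')
      (h : Y ⟶ Y') :
      ContourRel B (par₁ (B.str.par.split.act f a g h))
        (((hom₁ g).tensor (hom₁ h)).comp ((par₁ a).comp (hom₁ f)))
  -- sequential associativity, `α(a | b) = (c | d)`
  | seq_assoc₀ {A X Y Z U W : B.carrier} (a : B.SeqSplit A U Z) (b : B.SeqSplit U X Y)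
      (c : B.SeqSplit A X W) (d : B.SeqSplit W Y Z)
      (e : B.str.seq.assoc A X Y Z (mkL a b) = mkR c d) :
      ContourRel B ((seq₀ a).comp (seq₀ b)) (seq₀ c)
  | seq_assoc₁ {A X Y Z U W : B.carrier} (a : B.SeqSplit A U Z) (b : B.SeqSplit U X Y)
      (c : B.SeqSplit A X W) (d : B.SeqSplit W Y Z)
      (e : B.str.seq.assoc A X Y Z (mkL a b) = mkR c d) :
      ContourRel B (seq₁ b) ((seq₁ c).comp (seq₀ d))
  | seq_assoc₂ {A X Y Z U W : B.carrier} (a : B.SeqSplit A U Z) (b : B.SeqSplit U X Y)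
      (c : B.SeqSplit A X W) (d : B.SeqSplit W Y Z)
      (e : B.str.seq.assoc A X Y Z (mkL a b) = mkR c d) :
      ContourRel B ((seq₂ b).comp (seq₁ a)) (seq₁ d)
  | seq_assoc₃ {A X Y Z U W : B.carrier} (a : B.SeqSplit A U Z) (b : B.SeqSplit U X Y)
      (c : B.SeqSplit A X W) (d : B.SeqSplit W Y Z)
      (e : B.str.seq.assoc A X Y Z (mkL a b) = mkR c d) :
      ContourRel B (seq₂ a) ((seq₂ d).comp (seq₂ c))
  -- sequential unitality, `λ(a | n) = c` and `ρ(a | n) = c`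
  | seq_lam₀ {A X U : B.carrier} (a : B.SeqSplit A U X) (n : B.SeqUnit U) :
      ContourRel B (hom₀ (B.str.seq.lam A X (mkL a n)))
        ((seq₀ a).comp ((seqUnit₀ n).comp (seq₁ a)))
  | seq_lam₁ {A X U : B.carrier} (a : B.SeqSplit A U X) (n : B.SeqUnit U) :
      ContourRel B (hom₁ (B.str.seq.lam A X (mkL a n))) (seq₂ a)
  | seq_rho₀ {A X U : B.carrier} (a : B.SeqSplit A X U) (n : B.SeqUnit U) :
      ContourRel B (hom₀ (B.str.seq.rho A X (mkR a n))) (seq₀ a)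
  | seq_rho₁ {A X U : B.carrier} (a : B.SeqSplit A X U) (n : B.SeqUnit U) :
      ContourRel B (hom₁ (B.str.seq.rho A X (mkR a n)))
        ((seq₁ a).comp ((seqUnit₀ n).comp (seq₂ a)))
  -- parallel associativity, `α(a | b) = (c | d)`
  | par_assoc₀ {A X Y Z U W : B.carrier} (a : B.ParSplit A U Z) (b : B.ParSplit U X Y)
      (c : B.ParSplit A X W) (d : B.ParSplit W Y Z)
      (e : B.str.par.assoc A X Y Z (mkL a b) = mkR c d) :
      ContourRel B ((par₀ a).comp (((par₀ b).tensor (ident (L Z))).comp (assoc_hom _ _ _)))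
        ((par₀ c).comp ((ident (L X)).tensor (par₀ d)))
  | par_assoc₁ {A X Y Z U W : B.carrier} (a : B.ParSplit A U Z) (b : B.ParSplit U X Y)
      (c : B.ParSplit A X W) (d : B.ParSplit W Y Z)
      (e : B.str.par.assoc A X Y Z (mkL a b) = mkR c d) :
      ContourRel B ((assoc_inv _ _ _).comp (((par₁ b).tensor (ident (R Z))).comp (par₁ a)))
        (((ident (R X)).tensor (par₁ d)).comp (par₁ c))
  -- parallel unitality, `λ(a | i) = c` and `ρ(a | i) = c`
  | par_lam₀ {A X U : B.carrier} (a : B.ParSplit A U X) (i : B.ParUnit U) :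
      ContourRel B (hom₀ (B.str.par.lam A X (mkL a i)))
        ((par₀ a).comp (((parUnit₀ i).tensor (ident (L X))).comp (lam_hom _)))
  | par_lam₁ {A X U : B.carrier} (a : B.ParSplit A U X) (i : B.ParUnit U) :
      ContourRel B (hom₁ (B.str.par.lam A X (mkL a i)))
        ((lam_inv _).comp (((parUnit₁ i).tensor (ident (R X))).comp (par₁ a)))
  | par_rho₀ {A X U : B.carrier} (a : B.ParSplit A X U) (i : B.ParUnit U) :
      ContourRel B (hom₀ (B.str.par.rho A X (mkR a i)))
        ((par₀ a).comp (((ident (L X)).tensor (parUnit₀ i)).comp (rho_hom _)))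
  | par_rho₁ {A X U : B.carrier} (a : B.ParSplit A X U) (i : B.ParUnit U) :
      ContourRel B (hom₁ (B.str.par.rho A X (mkR a i)))
        ((rho_inv _).comp (((ident (R X)).tensor (parUnit₁ i)).comp (par₁ a)))
  -- `ψ₂(a | b | c) = (d | e | f)`
  | psi₂₀ {A X Y Z W U U' G H : B.carrier} (a : B.ParSplit A U U') (b : B.SeqSplit U X Y)
      (c : B.SeqSplit U' Z W) (d : B.SeqSplit A G H) (e : B.ParSplit G X Z)
      (f : B.ParSplit H Y W) (h : B.str.psi₂ A X Y Z W (mk₂ a b c) = mk₂ d e f) :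
      ContourRel B ((par₀ a).comp ((seq₀ b).tensor (seq₀ c))) ((seq₀ d).comp (par₀ e))
  | psi₂₁ {A X Y Z W U U' G H : B.carrier} (a : B.ParSplit A U U') (b : B.SeqSplit U X Y)
      (c : B.SeqSplit U' Z W) (d : B.SeqSplit A G H) (e : B.ParSplit G X Z)
      (f : B.ParSplit H Y W) (h : B.str.psi₂ A X Y Z W (mk₂ a b c) = mk₂ d e f) :
      ContourRel B ((seq₁ b).tensor (seq₁ c)) ((par₁ e).comp ((seq₁ d).comp (par₀ f)))
  | psi₂₂ {A X Y Z W U U' G H : B.carrier} (a : B.ParSplit A U U') (b : B.SeqSplit U X Y)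
      (c : B.SeqSplit U' Z W) (d : B.SeqSplit A G H) (e : B.ParSplit G X Z)
      (f : B.ParSplit H Y W) (h : B.str.psi₂ A X Y Z W (mk₂ a b c) = mk₂ d e f) :
      ContourRel B (((seq₂ b).tensor (seq₂ c)).comp (par₁ a)) ((par₁ f).comp (seq₂ d))
  -- `ψ₀(a) = (b | c | d)`
  | psi₀₀ {A G H : B.carrier} (a : B.ParUnit A) (b : B.SeqSplit A G H) (c : B.ParUnit G)
      (d : B.ParUnit H) (h : B.str.psi₀ A a = mk₂ b c d) :
      ContourRel B (parUnit₀ a) ((seq₀ b).comp (parUnit₀ c))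
  | psi₀₁ {A G H : B.carrier} (a : B.ParUnit A) (b : B.SeqSplit A G H) (c : B.ParUnit G)
      (d : B.ParUnit H) (h : B.str.psi₀ A a = mk₂ b c d) :
      ContourRel B (ident unit) ((parUnit₁ c).comp ((seq₁ b).comp (parUnit₀ d)))
  | psi₀₂ {A G H : B.carrier} (a : B.ParUnit A) (b : B.SeqSplit A G H) (c : B.ParUnit G)
      (d : B.ParUnit H) (h : B.str.psi₀ A a = mk₂ b c d) :
      ContourRel B (parUnit₁ a) ((parUnit₁ d).comp (seq₂ b))
  -- `φ₂(a | b | c) = d` and `φ₀(a) = b`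
  | phi₂ {A U W : B.carrier} (a : B.ParSplit A U W) (b : B.SeqUnit U) (c : B.SeqUnit W) :
      ContourRel B ((par₀ a).comp (((seqUnit₀ b).tensor (seqUnit₀ c)).comp (par₁ a)))
        (seqUnit₀ (B.str.phi₂ A (mk₂ a b c)))
  | phi₀ {A : B.carrier} (a : B.ParUnit A) :
      ContourRel B ((parUnit₀ a).comp (parUnit₁ a)) (seqUnit₀ (B.str.phi₀ A a))

namespace Contour

variable (B : PDuo.{u})

/-- the equivalence of formal morphisms -/
instance setoid (X Y : ContourObj B) : Setoid (ContourHom B X Y) :=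
  ⟨ContourRel B, .refl, .symm, .trans⟩

instance : SmallCategory (ContourObj B) where
  Hom X Y := Quotient (setoid B X Y)
  id X := ⟦.ident X⟧
  comp f g := Quotient.map₂ .comp (fun _ _ h _ _ h' => .comp h h') f g
  id_comp := by rintro X Y ⟨f⟩; exact Quotient.sound (.id_comp f)
  comp_id := by rintro X Y ⟨f⟩; exact Quotient.sound (.comp_id f)
  assoc := by rintro X Y Z W ⟨f⟩ ⟨g⟩ ⟨h⟩; exact Quotient.sound (.comp_assoc f g h)

variable {B}

/-- the morphism presented by a formal morphism -/
def mk {X Y : ContourObj B} (f : ContourHom B X Y) : X ⟶ Y := Quotient.mk _ f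

theorem mk_sound {X Y : ContourObj B} {f g : ContourHom B X Y} (h : ContourRel B f g) :
    mk f = mk g := Quotient.sound h

theorem mk_comp {X Y Z : ContourObj B} (f : ContourHom B X Y) (g : ContourHom B Y Z) :
    mk (f.comp g) = mk f ≫ mk g := rfl

theorem mk_id (X : ContourObj B) : mk (.ident X) = 𝟙 X := rfl

/-- the tensor of morphisms -/
def tensorHom {X Y X' Y' : ContourObj B} (f : X ⟶ Y) (g : X' ⟶ Y') :
    X.tensor X' ⟶ Y.tensor Y' :=
  Quotient.map₂ .tensor (fun _ _ h _ _ h' => .tensor h h') f g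

instance : MonoidalCategoryStruct (ContourObj B) where
  tensorObj := .tensor
  tensorUnit := .unit
  tensorHom f g := tensorHom f g
  whiskerLeft X _ _ f := tensorHom (𝟙 X) f
  whiskerRight f Y := tensorHom f (𝟙 Y)
  associator X Y Z := ⟨mk (.assoc_hom X Y Z), mk (.assoc_inv X Y Z),
    mk_sound (.assoc_hom_inv X Y Z), mk_sound (.assoc_inv_hom X Y Z)⟩
  leftUnitor X := ⟨mk (.lam_hom X), mk (.lam_inv X),
    mk_sound (.lam_hom_inv X), mk_sound (.lam_inv_hom X)⟩
  rightUnitor X := ⟨mk (.rho_hom X), mk (.rho_inv X),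
    mk_sound (.rho_hom_inv X), mk_sound (.rho_inv_hom X)⟩

instance : MonoidalCategory (ContourObj B) := MonoidalCategory.ofTensorHom
  (id_tensorHom_id := fun X Y => mk_sound (.id_tensor_id X Y))
  (tensorHom_comp_tensorHom := by
    rintro _ _ _ _ _ _ ⟨f⟩ ⟨f'⟩ ⟨g⟩ ⟨g'⟩; exact mk_sound (.tensor_comp f f' g g'))
  (associator_naturality := by
    rintro _ _ _ _ _ _ ⟨f⟩ ⟨g⟩ ⟨h⟩; exact mk_sound (.assoc_naturality f g h))
  (leftUnitor_naturality := by rintro _ _ ⟨f⟩; exact mk_sound (.lam_naturality f))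
  (rightUnitor_naturality := by rintro _ _ ⟨f⟩; exact mk_sound (.rho_naturality f))
  (pentagon := fun X Y Z W => mk_sound (.pentagon X Y Z W))
  (triangle := fun X Y => mk_sound (.triangle X Y))

end Contour

/-- The monoidal contour of a produoidal category. -/
@[reducible]
def contour (B : PDuo.{u}) : MonoCat.{u} where
  carrier := ContourObj B

namespace Contour

variable {B C D : PDuo.{u}}

/-- The action of a produoidal functor on the objects of the contour. -/
def mapObj (F : PDuoFunctor B C) : ContourObj B → ContourObj C
  | .L X => .L (F.fn.obj X)
  | .R X => .R (F.fn.obj X)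
  | .unit => .unit
  | .tensor X Y => .tensor (mapObj F X) (mapObj F Y)

/-- The action of a produoidal functor on the formal morphisms of the contour. -/
def mapHom (F : PDuoFunctor B C) {X Y : ContourObj B} :
    ContourHom B X Y → ContourHom C (mapObj F X) (mapObj F Y)
  | .ident X => .ident (mapObj F X)
  | .comp f g => .comp (mapHom F f) (mapHom F g)
  | .tensor f g => .tensor (mapHom F f) (mapHom F g)
  | .assoc_hom X Y Z => .assoc_hom (mapObj F X) (mapObj F Y) (mapObj F Z)
  | .assoc_inv X Y Z => .assoc_inv (mapObj F X) (mapObj F Y) (mapObj F Z)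
  | .lam_hom X => .lam_hom (mapObj F X)
  | .lam_inv X => .lam_inv (mapObj F X)
  | .rho_hom X => .rho_hom (mapObj F X)
  | .rho_inv X => .rho_inv (mapObj F X)
  | .hom₀ a => .hom₀ (F.fn.map a)
  | .hom₁ a => .hom₁ (F.fn.map a)
  | .seqUnit₀ a => .seqUnit₀ (F.mapSeqUnit a)
  | .parUnit₀ a => .parUnit₀ (F.mapParUnit a)
  | .parUnit₁ a => .parUnit₁ (F.mapParUnit a)
  | .seq₀ a => .seq₀ (F.mapSeq a)
  | .seq₁ a => .seq₁ (F.mapSeq a)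
  | .seq₂ a => .seq₂ (F.mapSeq a)
  | .par₀ a => .par₀ (F.mapPar a)
  | .par₁ a => .par₁ (F.mapPar a)

theorem mapHom_rel (F : PDuoFunctor B C) {X Y : ContourObj B} {f g : ContourHom B X Y}
    (h : ContourRel B f g) : ContourRel C (mapHom F f) (mapHom F g) := by
  induction h with
  | refl f => exact .refl _
  | symm _ ih => exact .symm ih
  | trans _ _ ih ih' => exact .trans ih ih'
  | comp _ _ ih ih' => exact .comp ih ih'
  | tensor _ _ ih ih' => exact .tensor ih ih'
  | id_comp f => exact .id_comp _
  | comp_id f => exact .comp_id _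
  | comp_assoc f g h => exact .comp_assoc _ _ _
  | id_tensor_id X Y => exact .id_tensor_id _ _
  | tensor_comp f f' g g' => exact .tensor_comp _ _ _ _
  | assoc_hom_inv X Y Z => exact .assoc_hom_inv _ _ _
  | assoc_inv_hom X Y Z => exact .assoc_inv_hom _ _ _
  | lam_hom_inv X => exact .lam_hom_inv _
  | lam_inv_hom X => exact .lam_inv_hom _
  | rho_hom_inv X => exact .rho_hom_inv _
  | rho_inv_hom X => exact .rho_inv_hom _
  | assoc_naturality f g h => exact .assoc_naturality _ _ _
  | lam_naturality f => exact .lam_naturality _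
  | rho_naturality f => exact .rho_naturality _
  | pentagon X Y Z W => exact .pentagon _ _ _ _
  | triangle X Y => exact .triangle _ _
  | hom₀_id A => simp only [mapHom, F.fn.map_id]; exact .hom₀_id _
  | hom₁_id A => simp only [mapHom, F.fn.map_id]; exact .hom₁_id _
  | hom₀_comp f g => simp only [mapHom, F.fn.map_comp]; exact .hom₀_comp _ _
  | hom₁_comp f g => simp only [mapHom, F.fn.map_comp]; exact .hom₁_comp _ _
  | seqUnit₀_act f a => simp only [mapHom, F.mapSeqUnit_natural]; exact .seqUnit₀_act _ _
  | parUnit₀_act f a => simp only [mapHom, F.mapParUnit_natural]; exact .parUnit₀_act _ _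
  | parUnit₁_act f a => simp only [mapHom, F.mapParUnit_natural]; exact .parUnit₁_act _ _
  | seq₀_act f a g h => simp only [mapHom, F.mapSeq_natural]; exact .seq₀_act _ _ _ _
  | seq₁_act f a g h => simp only [mapHom, F.mapSeq_natural]; exact .seq₁_act _ _ _ _
  | seq₂_act f a g h => simp only [mapHom, F.mapSeq_natural]; exact .seq₂_act _ _ _ _
  | par₀_act f a g h => simp only [mapHom, F.mapPar_natural]; exact .par₀_act _ _ _ _
  | par₁_act f a g h => simp only [mapHom, F.mapPar_natural]; exact .par₁_act _ _ _ _
  | seq_assoc₀ a b c d e => exact .seq_assoc₀ _ _ _ _ (F.seq_assoc _ _ _ _ e)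
  | seq_assoc₁ a b c d e => exact .seq_assoc₁ _ _ _ _ (F.seq_assoc _ _ _ _ e)
  | seq_assoc₂ a b c d e => exact .seq_assoc₂ _ _ _ _ (F.seq_assoc _ _ _ _ e)
  | seq_assoc₃ a b c d e => exact .seq_assoc₃ _ _ _ _ (F.seq_assoc _ _ _ _ e)
  | seq_lam₀ a n => simp only [mapHom, F.seq_lam]; exact .seq_lam₀ _ _
  | seq_lam₁ a n => simp only [mapHom, F.seq_lam]; exact .seq_lam₁ _ _
  | seq_rho₀ a n => simp only [mapHom, F.seq_rho]; exact .seq_rho₀ _ _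
  | seq_rho₁ a n => simp only [mapHom, F.seq_rho]; exact .seq_rho₁ _ _
  | par_assoc₀ a b c d e => exact .par_assoc₀ _ _ _ _ (F.par_assoc _ _ _ _ e)
  | par_assoc₁ a b c d e => exact .par_assoc₁ _ _ _ _ (F.par_assoc _ _ _ _ e)
  | par_lam₀ a i => simp only [mapHom, F.par_lam]; exact .par_lam₀ _ _
  | par_lam₁ a i => simp only [mapHom, F.par_lam]; exact .par_lam₁ _ _
  | par_rho₀ a i => simp only [mapHom, F.par_rho]; exact .par_rho₀ _ _
  | par_rho₁ a i => simp only [mapHom, F.par_rho]; exact .par_rho₁ _ _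
  | psi₂₀ a b c d e f h => exact .psi₂₀ _ _ _ _ _ _ (F.psi₂ _ _ _ _ _ _ h)
  | psi₂₁ a b c d e f h => exact .psi₂₁ _ _ _ _ _ _ (F.psi₂ _ _ _ _ _ _ h)
  | psi₂₂ a b c d e f h => exact .psi₂₂ _ _ _ _ _ _ (F.psi₂ _ _ _ _ _ _ h)
  | psi₀₀ a b c d h => exact .psi₀₀ _ _ _ _ (F.psi₀ _ _ _ _ h)
  | psi₀₁ a b c d h => exact .psi₀₁ _ _ _ _ (F.psi₀ _ _ _ _ h)
  | psi₀₂ a b c d h => exact .psi₀₂ _ _ _ _ (F.psi₀ _ _ _ _ h)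
  | phi₂ a b c => simp only [mapHom, F.phi₂]; exact .phi₂ _ _ _
  | phi₀ a => simp only [mapHom, F.phi₀]; exact .phi₀ _

theorem comp_heq {X Y Z X' Y' Z' : ContourObj B} (hX : X = X') (hY : Y = Y') (hZ : Z = Z')
    {f : ContourHom B X Y} {g : ContourHom B Y Z} {f' : ContourHom B X' Y'}
    {g' : ContourHom B Y' Z'} (hf : HEq f f') (hg : HEq g g') :
    HEq (f.comp g) (f'.comp g') := by
  subst hX hY hZ; cases hf; cases hg; rfl

theorem tensor_heq {X Y Z W X' Y' Z' W' : ContourObj B} (hX : X = X') (hY : Y = Y')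
    (hZ : Z = Z') (hW : W = W') {f : ContourHom B X Y} {g : ContourHom B Z W}
    {f' : ContourHom B X' Y'} {g' : ContourHom B Z' W'} (hf : HEq f f') (hg : HEq g g') :
    HEq (f.tensor g) (f'.tensor g') := by
  subst hX hY hZ hW; cases hf; cases hg; rfl

theorem assoc_hom_heq {X Y Z X' Y' Z' : ContourObj B} (hX : X = X') (hY : Y = Y') (hZ : Z = Z') :
    HEq (ContourHom.assoc_hom X Y Z) (ContourHom.assoc_hom X' Y' Z') := by
  subst hX hY hZ; rfl

theorem assoc_inv_heq {X Y Z X' Y' Z' : ContourObj B} (hX : X = X') (hY : Y = Y') (hZ : Z = Z') :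
    HEq (ContourHom.assoc_inv X Y Z) (ContourHom.assoc_inv X' Y' Z') := by
  subst hX hY hZ; rfl

theorem mapObj_id (X : ContourObj B) : mapObj (PDuoFunctor.id B) X = X := by
  induction X with
  | L X => rfl
  | R X => rfl
  | unit => rfl
  | tensor X Y hX hY => exact congrArg₂ ContourObj.tensor hX hY

theorem mapObj_comp (F : PDuoFunctor B C) (G : PDuoFunctor C D) (X : ContourObj B) :
    mapObj (F.comp G) X = mapObj G (mapObj F X) := by
  induction X with
  | L X => rfl
  | R X => rfl
  | unit => rfl
  | tensor X Y hX hY => exact congrArg₂ ContourObj.tensor hX hY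

theorem mapHom_id {X Y : ContourObj B} (f : ContourHom B X Y) :
    HEq (mapHom (PDuoFunctor.id B) f) f := by
  induction f with
  | comp f g hf hg => exact comp_heq (mapObj_id _) (mapObj_id _) (mapObj_id _) hf hg
  | tensor f g hf hg =>
    exact tensor_heq (mapObj_id _) (mapObj_id _) (mapObj_id _) (mapObj_id _) hf hg
  | ident X => exact congr_arg_heq ContourHom.ident (mapObj_id X)
  | assoc_hom X Y Z =>
    exact assoc_hom_heq (mapObj_id X) (mapObj_id Y) (mapObj_id Z)
  | assoc_inv X Y Z =>
    exact assoc_inv_heq (mapObj_id X) (mapObj_id Y) (mapObj_id Z)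
  | lam_hom X => exact congr_arg_heq ContourHom.lam_hom (mapObj_id X)
  | lam_inv X => exact congr_arg_heq ContourHom.lam_inv (mapObj_id X)
  | rho_hom X => exact congr_arg_heq ContourHom.rho_hom (mapObj_id X)
  | rho_inv X => exact congr_arg_heq ContourHom.rho_inv (mapObj_id X)
  | _ => rfl

theorem mapHom_comp (F : PDuoFunctor B C) (G : PDuoFunctor C D) {X Y : ContourObj B}
    (f : ContourHom B X Y) : HEq (mapHom (F.comp G) f) (mapHom G (mapHom F f)) := by
  induction f with
  | comp f g hf hg =>
    exact comp_heq (mapObj_comp F G _) (mapObj_comp F G _) (mapObj_comp F G _) hf hg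
  | tensor f g hf hg =>
    exact tensor_heq (mapObj_comp F G _) (mapObj_comp F G _) (mapObj_comp F G _)
      (mapObj_comp F G _) hf hg
  | ident X => exact congr_arg_heq ContourHom.ident (mapObj_comp F G X)
  | assoc_hom X Y Z =>
    exact assoc_hom_heq (mapObj_comp F G X) (mapObj_comp F G Y) (mapObj_comp F G Z)
  | assoc_inv X Y Z =>
    exact assoc_inv_heq (mapObj_comp F G X) (mapObj_comp F G Y) (mapObj_comp F G Z)
  | lam_hom X => exact congr_arg_heq ContourHom.lam_hom (mapObj_comp F G X)
  | lam_inv X => exact congr_arg_heq ContourHom.lam_inv (mapObj_comp F G X)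
  | rho_hom X => exact congr_arg_heq ContourHom.rho_hom (mapObj_comp F G X)
  | rho_inv X => exact congr_arg_heq ContourHom.rho_inv (mapObj_comp F G X)
  | _ => rfl

theorem mk_heq {X Y X' Y' : ContourObj B} (hX : X = X') (hY : Y = Y') {f : ContourHom B X Y}
    {f' : ContourHom B X' Y'} (hf : HEq f f') : HEq (mk f) (mk f') := by
  subst hX hY; cases hf; rfl

/-- The action of a produoidal functor on contours. -/
def map (F : PDuoFunctor B C) : StrictMonoidalFunctor (contour B) (contour C) where
  fn :=
    { obj := mapObj F
      map := fun f => Quotient.map (mapHom F) (fun _ _ h => mapHom_rel F h) f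
      map_id := fun _ => rfl
      map_comp := by rintro _ _ _ ⟨f⟩ ⟨g⟩; rfl }
  obj_unit := rfl
  obj_tensor _ _ := rfl
  map_tensor := by
    rintro _ _ _ _ ⟨f⟩ ⟨g⟩
    exact ((Category.id_comp _).trans (Category.comp_id _)).symm
  map_associator _ _ _ := by
    exact ((Category.id_comp _).trans (Category.comp_id _)).symm
  map_leftUnitor _ := by
    exact (Category.id_comp _).symm
  map_rightUnitor _ := by
    exact (Category.id_comp _).symm

end Contour

/-- The functor sending a produoidal category to its monoidal contour. -/
def contourFunctor : PDuo.{u} ⥤ MonoCat.{u} where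
  obj := contour
  map F := Contour.map F
  map_id B := by
    apply StrictMonoidalFunctor.ext
    refine Functor.hext (fun X => Contour.mapObj_id X) ?_
    rintro X Y ⟨f⟩
    exact Contour.mk_heq (Contour.mapObj_id _) (Contour.mapObj_id _) (Contour.mapHom_id f)
  map_comp F G := by
    apply StrictMonoidalFunctor.ext
    refine Functor.hext (fun X => Contour.mapObj_comp F G X) ?_
    rintro X Y ⟨f⟩
    exact Contour.mk_heq (Contour.mapObj_comp F G _) (Contour.mapObj_comp F G _)
      (Contour.mapHom_comp F G f)

end Produo

/-! The contour is given by generators and relations, so the adjunction is its universal property,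
once the presentation is recognised as the definition of the splice read in the other direction. Let
`G : B → splice C` be a produoidal functor. On an object it chooses a pair of objects of `C`, the
values of the two generators `L X` and `R X`. On a morphism, split or unit it chooses a tuple of
arrows of `C`, with exactly the domains and codomains of the generators attached to that morphism,
split or unit. Thus the raw data of `G` and an assignment of the generators of the contour in `C`
are the same thing.

The conditions match as well. Functoriality and naturality of `G`, read componentwise, are the
functoriality relations of the contour. In the splice, an equation such as `α(a | b) = (c | d)` or
`ψ₂(a | b | c) = (d | e | f)` between classes in a coend is equivalent to a few equations between
composites in `C`, by `parAssoc_iff`, `seqAssoc_iff`, `psi₂_iff` and `psi₀_iff`; the unitors, `φ₂`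
and `φ₀` are given by explicit composites. These are the remaining relations of the contour. Both
the definition of a produoidal functor and the relations refer to arbitrary representatives of coend
classes, so no choice of representatives has to be made.

Used from right to left, the equivalences show that sending everything to its generators is a
produoidal functor `contourUnit`, the unit of the adjunction. Used from left to right, they show in
`liftHom_rel` that the extension of `G` to formal morphisms respects the relations, which gives the
strict monoidal functor `contourLift G`.

The extension is inverse to restriction along the unit. Restricting an extension returns `G` because
the extension has the prescribed values on generators (`restrict_contourLift`). Extending a
restriction returns the strict functor `F` because a strict functor is determined by its values on
generators, by induction on formal morphisms (`liftHom_restrict`). The induction is carried out with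
heterogeneous equality, since `F` preserves tensor and unit up to an equality of objects that need
not hold by definition.

Transposition has the form `F ↦ η ≫ T F`, so its naturality follows from functoriality of the splice
and naturality of `η` (`contourUnitHom_naturality`). -/

namespace Produo

open Splice

/-! ### The unit of the adjunction: sending each element to its generators. -/

section Unit

open Contour

variable (B : PDuo.{u})

/-- The inclusion of generators of a produoidal category into the splice of its contour. -/
def contourUnit : PDuoFunctor B (splice (contour B)) where
  fn :=
    { obj := fun A => ⟨.L A, .R A⟩
      map := fun f => ⟨mk (.hom₀ f), mk (.hom₁ f)⟩
      map_id := fun A => Splice.hom_ext (mk_sound (.hom₀_id A)) (mk_sound (.hom₁_id A))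
      map_comp := fun f g =>
        Splice.hom_ext (mk_sound (.hom₀_comp f g)) (mk_sound (.hom₁_comp f g)) }
  -- The tensor of two objects of the contour is by definition the formal node `ContourObj.tensor`,
  -- so the generators attached to a split or a unit already have the types that the splice
  -- requires.
  mapPar t := ⟨mk (.par₀ t), mk (.par₁ t)⟩
  mapParUnit i := ⟨mk (.parUnit₀ i), mk (.parUnit₁ i)⟩
  mapSeq s := ⟨mk (.seq₀ s), mk (.seq₁ s), mk (.seq₂ s)⟩
  mapSeqUnit n := mk (.seqUnit₀ n)
  -- In the splice, each component of an action is the right-nested composite that stands on the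
  -- right of the corresponding relation; hence every naturality law is one relation per component.
  mapPar_natural f t g h :=
    ParSplit.ext (mk_sound (.par₀_act f t g h)) (mk_sound (.par₁_act f t g h))
  mapParUnit_natural f i :=
    ParUnit.ext (mk_sound (.parUnit₀_act f i)) (mk_sound (.parUnit₁_act f i))
  mapSeq_natural f s g h :=
    SeqSplit.ext (mk_sound (.seq₀_act f s g h)) (mk_sound (.seq₁_act f s g h))
      (mk_sound (.seq₂_act f s g h))
  mapSeqUnit_natural f n := mk_sound (.seqUnit₀_act f n)
  -- An equality of coend classes is replaced by equations between composites, each of which is a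
  -- relation of the contour. The criterion is phrased with whiskerings and the relations with
  -- tensors by identities; in the contour the former are defined as the latter.
  par_assoc a b c d e := (parAssoc_iff _ _ _ _).2
    ⟨mk_sound (.par_assoc₀ a b c d e), mk_sound (.par_assoc₁ a b c d e)⟩
  -- The unitors of the splice compute on a representative, so no criterion for equality of coend
  -- classes is needed: the two components are the two relations.
  par_lam a i := Splice.hom_ext (mk_sound (.par_lam₀ a i)) (mk_sound (.par_lam₁ a i))
  par_rho a i := Splice.hom_ext (mk_sound (.par_rho₀ a i)) (mk_sound (.par_rho₁ a i))
  seq_assoc a b c d e := (seqAssoc_iff _ _ _ _).2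
    ⟨mk_sound (.seq_assoc₀ a b c d e), mk_sound (.seq_assoc₁ a b c d e),
      mk_sound (.seq_assoc₂ a b c d e), mk_sound (.seq_assoc₃ a b c d e)⟩
  seq_lam a n := Splice.hom_ext (mk_sound (.seq_lam₀ a n)) (mk_sound (.seq_lam₁ a n))
  seq_rho a n := Splice.hom_ext (mk_sound (.seq_rho₀ a n)) (mk_sound (.seq_rho₁ a n))
  psi₂ a b c d e e' h := (psi₂_iff _ _ _ _ _ _).2
    ⟨mk_sound (.psi₂₀ a b c d e e' h), mk_sound (.psi₂₁ a b c d e e' h),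
      mk_sound (.psi₂₂ a b c d e e' h)⟩
  psi₀ i s j k h := (psi₀_iff _ _ _ _).2
    ⟨mk_sound (.psi₀₀ i s j k h), mk_sound (.psi₀₁ i s j k h), mk_sound (.psi₀₂ i s j k h)⟩
  -- The relation leads from the composite to the generator of `φ₂(t | n | m)`, whereas preservation
  -- of `φ₂` is stated in the opposite direction.
  phi₂ t n m := (mk_sound (.phi₂ t n m)).symm
  phi₀ i := (mk_sound (.phi₀ i)).symm

end Unit

/-! ### The universal property: extension from generators and restriction to them. -/

section Lift

variable {B : PDuo.{u}} {C : MonoCat.{u}}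

/-- The extension of a produoidal functor into a splice to the objects of the contour. -/
def liftObj (G : PDuoFunctor B (splice C)) : ContourObj B → C.carrier
  | .L X => (G.fn.obj X).l
  | .R X => (G.fn.obj X).r
  | .unit => 𝟙_ C.carrier
  | .tensor X Y => liftObj G X ⊗ liftObj G Y

/-- The extension of a produoidal functor into a splice to the formal morphisms of the
contour. -/
def liftHom (G : PDuoFunctor B (splice C)) {X Y : ContourObj B} :
    ContourHom B X Y → (liftObj G X ⟶ liftObj G Y)
  | .ident X => 𝟙 (liftObj G X)
  | .comp f g => liftHom G f ≫ liftHom G g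
  | .tensor f g => liftHom G f ⊗ₘ liftHom G g
  | .assoc_hom X Y Z => (α_ (liftObj G X) (liftObj G Y) (liftObj G Z)).hom
  | .assoc_inv X Y Z => (α_ (liftObj G X) (liftObj G Y) (liftObj G Z)).inv
  | .lam_hom X => (λ_ (liftObj G X)).hom
  | .lam_inv X => (λ_ (liftObj G X)).inv
  | .rho_hom X => (ρ_ (liftObj G X)).hom
  | .rho_inv X => (ρ_ (liftObj G X)).inv
  | .hom₀ a => Hom.f₀ (G.fn.map a)
  | .hom₁ a => Hom.f₁ (G.fn.map a)
  | .seqUnit₀ a => G.mapSeqUnit a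
  | .parUnit₀ a => ParUnit.f₀ (G.mapParUnit a)
  | .parUnit₁ a => ParUnit.f₁ (G.mapParUnit a)
  | .seq₀ a => SeqSplit.f₀ (G.mapSeq a)
  | .seq₁ a => SeqSplit.f₁ (G.mapSeq a)
  | .seq₂ a => SeqSplit.f₂ (G.mapSeq a)
  | .par₀ a => ParSplit.f₀ (G.mapPar a)
  | .par₁ a => ParSplit.f₁ (G.mapPar a)

/-- This is what allows the extension to descend to the quotient. Each relation holds in `C` for one
of three reasons: it is a closure rule or a law of monoidal categories, it is a component of a
functoriality or naturality law of `G`, or it is a component of the statement that `G` preserves a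
coherence map or a laxator, read off in the splice. -/
theorem liftHom_rel (G : PDuoFunctor B (splice C)) {X Y : ContourObj B} {f g : ContourHom B X Y}
    (h : ContourRel B f g) : liftHom G f = liftHom G g := by
  induction h with
  | refl f => rfl
  | symm _ ih => exact ih.symm
  | trans _ _ ih ih' => exact ih.trans ih'
  | comp _ _ ih ih' => exact congrArg₂ (· ≫ ·) ih ih'
  | tensor _ _ ih ih' => exact congrArg₂ (· ⊗ₘ ·) ih ih'
  | id_comp f => exact Category.id_comp _
  | comp_id f => exact Category.comp_id _
  | comp_assoc f g h => exact Category.assoc _ _ _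
  | id_tensor_id X Y => exact id_tensorHom_id _ _
  | tensor_comp f f' g g' => exact tensorHom_comp_tensorHom _ _ _ _
  | assoc_hom_inv X Y Z => exact Iso.hom_inv_id _
  | assoc_inv_hom X Y Z => exact Iso.inv_hom_id _
  | lam_hom_inv X => exact Iso.hom_inv_id _
  | lam_inv_hom X => exact Iso.inv_hom_id _
  | rho_hom_inv X => exact Iso.hom_inv_id _
  | rho_inv_hom X => exact Iso.inv_hom_id _
  | assoc_naturality f g h => exact associator_naturality _ _ _
  -- The relation tensors with the identity of the unit, while naturality of the unitor in `C` is
  -- stated with a whiskering. In `C` the two are equal by a lemma and not by definition, so a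
  -- rewriting comes first.
  | lam_naturality f =>
    exact (congrArg (· ≫ _) (id_tensorHom _ _)).trans (leftUnitor_naturality _)
  | rho_naturality f =>
    exact (congrArg (· ≫ _) (tensorHom_id _ _)).trans (rightUnitor_naturality _)
  | pentagon X Y Z W => simp [liftHom, liftObj]
  | triangle X Y => simp [liftHom, liftObj]
  -- From here on each relation is a projection of one equation in the splice: an equation between
  -- tuples of arrows yields one equation in `C` for each component. Sequential units are single
  -- arrows, so for them there is nothing to project.
  | hom₀_id A => exact congrArg Hom.f₀ (G.fn.map_id A)
  | hom₁_id A => exact congrArg Hom.f₁ (G.fn.map_id A)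
  | hom₀_comp f g => exact congrArg Hom.f₀ (G.fn.map_comp f g)
  | hom₁_comp f g => exact congrArg Hom.f₁ (G.fn.map_comp f g)
  | seqUnit₀_act f a => exact G.mapSeqUnit_natural f a
  | parUnit₀_act f a => exact congrArg ParUnit.f₀ (G.mapParUnit_natural f a)
  | parUnit₁_act f a => exact congrArg ParUnit.f₁ (G.mapParUnit_natural f a)
  | seq₀_act f a g h => exact congrArg SeqSplit.f₀ (G.mapSeq_natural f a g h)
  | seq₁_act f a g h => exact congrArg SeqSplit.f₁ (G.mapSeq_natural f a g h)
  | seq₂_act f a g h => exact congrArg SeqSplit.f₂ (G.mapSeq_natural f a g h)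
  | par₀_act f a g h => exact congrArg ParSplit.f₀ (G.mapPar_natural f a g h)
  | par₁_act f a g h => exact congrArg ParSplit.f₁ (G.mapPar_natural f a g h)
  -- Preservation of the associator is an equality of coend classes in the splice; the criterion
  -- turns it into four equations in `C`, one for each of the four relations.
  | seq_assoc₀ a b c d e => exact ((seqAssoc_iff _ _ _ _).1 (G.seq_assoc _ _ _ _ e)).1
  | seq_assoc₁ a b c d e => exact ((seqAssoc_iff _ _ _ _).1 (G.seq_assoc _ _ _ _ e)).2.1
  | seq_assoc₂ a b c d e => exact ((seqAssoc_iff _ _ _ _).1 (G.seq_assoc _ _ _ _ e)).2.2.1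
  | seq_assoc₃ a b c d e => exact ((seqAssoc_iff _ _ _ _).1 (G.seq_assoc _ _ _ _ e)).2.2.2
  | seq_lam₀ a n => exact congrArg Hom.f₀ (G.seq_lam a n)
  | seq_lam₁ a n => exact congrArg Hom.f₁ (G.seq_lam a n)
  | seq_rho₀ a n => exact congrArg Hom.f₀ (G.seq_rho a n)
  | seq_rho₁ a n => exact congrArg Hom.f₁ (G.seq_rho a n)
  -- In the relations for the parallel associator and unitors, tensors by identities must again be
  -- turned into the whiskerings used by the splice; simplification does this.
  | par_assoc₀ a b c d e =>
    simpa [liftHom, liftObj] using ((parAssoc_iff _ _ _ _).1 (G.par_assoc _ _ _ _ e)).1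
  | par_assoc₁ a b c d e =>
    simpa [liftHom, liftObj] using ((parAssoc_iff _ _ _ _).1 (G.par_assoc _ _ _ _ e)).2
  | par_lam₀ a i => simpa [liftHom, liftObj] using congrArg Hom.f₀ (G.par_lam a i)
  | par_lam₁ a i => simpa [liftHom, liftObj] using congrArg Hom.f₁ (G.par_lam a i)
  | par_rho₀ a i => simpa [liftHom, liftObj] using congrArg Hom.f₀ (G.par_rho a i)
  | par_rho₁ a i => simpa [liftHom, liftObj] using congrArg Hom.f₁ (G.par_rho a i)
  -- The laxators involve only genuine tensors of two arrows, without whiskerings, so the components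
  -- agree with the relations as they stand.
  | psi₂₀ a b c d e f h => exact ((psi₂_iff _ _ _ _ _ _).1 (G.psi₂ _ _ _ _ _ _ h)).1
  | psi₂₁ a b c d e f h => exact ((psi₂_iff _ _ _ _ _ _).1 (G.psi₂ _ _ _ _ _ _ h)).2.1
  | psi₂₂ a b c d e f h => exact ((psi₂_iff _ _ _ _ _ _).1 (G.psi₂ _ _ _ _ _ _ h)).2.2
  | psi₀₀ a b c d h => exact ((psi₀_iff _ _ _ _).1 (G.psi₀ _ _ _ _ h)).1
  | psi₀₁ a b c d h => exact ((psi₀_iff _ _ _ _).1 (G.psi₀ _ _ _ _ h)).2.1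
  | psi₀₂ a b c d h => exact ((psi₀_iff _ _ _ _).1 (G.psi₀ _ _ _ _ h)).2.2
  | phi₂ a b c => exact (G.phi₂ a b c).symm
  | phi₀ a => exact (G.phi₀ a).symm

/-- The strict monoidal functor out of the contour induced by a produoidal functor into a
splice. -/
def contourLift (G : PDuoFunctor B (splice C)) : StrictMonoidalFunctor (contour B) C where
  fn :=
    { obj := liftObj G
      map := fun f => Quotient.lift (liftHom G) (fun _ _ h => liftHom_rel G h) f
      map_id := fun _ => rfl
      map_comp := by rintro _ _ _ ⟨f⟩ ⟨g⟩; rfl }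
  -- Tensor and unit of formal objects are interpreted by those of `C`, so strictness holds by
  -- definition. The transport morphisms in the laws below are therefore identities, and removing
  -- them leaves nothing to prove.
  obj_unit := rfl
  obj_tensor _ _ := rfl
  map_tensor := by
    rintro _ _ _ _ ⟨f⟩ ⟨g⟩
    exact ((Category.id_comp _).trans (Category.comp_id _)).symm
  map_associator _ _ _ := ((Category.id_comp _).trans (Category.comp_id _)).symm
  map_leftUnitor _ := (Category.id_comp _).symm
  map_rightUnitor _ := (Category.id_comp _).symm

/-- The produoidal functor into a splice obtained by restricting a strict monoidal functor to
the generators of the contour. -/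
abbrev restrict (F : StrictMonoidalFunctor (contour B) C) : PDuoFunctor B (splice C) :=
  (contourUnit B).comp (spliceMap F)

/-- The extension takes the prescribed values on generators by definition, so the underlying
functors agree definitionally and the remaining heterogeneous equalities become ordinary ones. Only
parallel splits and units need an argument: there `spliceMap` inserts transports along preservation
of tensor and unit, and for an extension these are identities. -/
theorem restrict_contourLift (G : PDuoFunctor B (splice C)) : restrict (contourLift G) = G := by
  refine PDuoFunctor.ext rfl (heq_of_eq ?_) (heq_of_eq ?_) (heq_of_eq ?_) (heq_of_eq ?_)
  · funext A X Y t
    exact ParSplit.ext (Category.comp_id _) (Category.id_comp _)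
  · funext A i
    exact ParUnit.ext (Category.comp_id _) (Category.id_comp _)
  · rfl
  · rfl

/-- The generating objects agree by definition, but at `unit` and `tensor` the equality is the
strictness of `F`, which is only a proof. For this reason morphisms are compared below by
heterogeneous equality. -/
theorem liftObj_restrict (F : StrictMonoidalFunctor (contour B) C) (X : ContourObj B) :
    liftObj (restrict F) X = F.fn.obj X := by
  induction X with
  | L X => rfl
  | R X => rfl
  | unit => exact F.obj_unit.symm
  | tensor X Y hX hY => exact (congrArg₂ (· ⊗ ·) hX hY).trans (F.obj_tensor X Y).symm

/-- This and the next two lemmas are the congruence rules for the induction on formal morphisms,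
where the endpoints of the two sides are equal without being definitionally equal. -/
theorem comp_heq_comp {D : Type u} [SmallCategory D] {X Y Z X' Y' Z' : D} (hX : X = X')
    (hY : Y = Y') (hZ : Z = Z') {f : X ⟶ Y} {g : Y ⟶ Z} {f' : X' ⟶ Y'} {g' : Y' ⟶ Z'}
    (hf : HEq f f') (hg : HEq g g') : HEq (f ≫ g) (f' ≫ g') := by
  subst hX hY hZ; cases hf; cases hg; rfl

theorem tensor_heq_tensor {D : Type u} [SmallCategory D] [MonoidalCategory D]
    {X Y Z W X' Y' Z' W' : D} (hX : X = X') (hY : Y = Y') (hZ : Z = Z') (hW : W = W')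
    {f : X ⟶ Y} {g : Z ⟶ W} {f' : X' ⟶ Y'} {g' : Z' ⟶ W'} (hf : HEq f f') (hg : HEq g g') :
    HEq (f ⊗ₘ g) (f' ⊗ₘ g') := by
  subst hX hY hZ hW; cases hf; cases hg; rfl

theorem associator_heq {D : Type u} [SmallCategory D] [MonoidalCategory D]
    {X Y Z X' Y' Z' : D} (hX : X = X') (hY : Y = Y') (hZ : Z = Z') :
    HEq (α_ X Y Z).hom (α_ X' Y' Z').hom ∧ HEq (α_ X Y Z).inv (α_ X' Y' Z').inv := by
  subst hX hY hZ; exact ⟨.rfl, .rfl⟩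

/-- This is the uniqueness half of the universal property. Every formal morphism is built from
generators by composition, tensor, identities and coherence maps, and a strict monoidal functor
preserves all of these, up to transports that heterogeneous equality ignores. -/
theorem liftHom_restrict (F : StrictMonoidalFunctor (contour B) C) {X Y : ContourObj B}
    (f : ContourHom B X Y) : HEq (liftHom (restrict F) f) (F.fn.map (Contour.mk f)) := by
  have obj := liftObj_restrict F
  induction f with
  | ident X =>
    exact (congr_arg_heq (fun Z => 𝟙 Z) (obj X)).trans (heq_of_eq (F.fn.map_id X).symm)
  | comp f g hf hg =>
    exact (comp_heq_comp (obj _) (obj _) (obj _) hf hg).trans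
      (heq_of_eq (F.fn.map_comp (Contour.mk f) (Contour.mk g)).symm)
  | tensor f g hf hg =>
    refine (tensor_heq_tensor (obj _) (obj _) (obj _) (obj _) hf hg).trans ?_
    -- Strictness expresses the image of a tensor as the tensor of the images between two
    -- transports; simplification discards these under heterogeneous equality. The coherence maps
    -- are treated in the same way.
    refine HEq.trans ?_ (heq_of_eq (F.map_tensor (Contour.mk f) (Contour.mk g)).symm)
    simp
  | assoc_hom X Y Z =>
    refine (associator_heq (obj X) (obj Y) (obj Z)).1.trans ?_
    refine HEq.trans ?_ (heq_of_eq (F.map_associator X Y Z).symm)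
    simp
  | assoc_inv X Y Z =>
    refine (associator_heq (obj X) (obj Y) (obj Z)).2.trans ?_
    -- Strictness is imposed on the forward coherence maps alone; the formula for an inverse is
    -- deduced by cancelling the image of the forward map.
    refine HEq.trans ?_ (heq_of_eq (F.map_associator_inv X Y Z).symm)
    simp
  | lam_hom X =>
    -- A unitor depends on a single object, so the general congruence rule for a function of one
    -- variable suffices.
    refine (congr_arg_heq (fun Z => (λ_ Z).hom) (obj X)).trans ?_
    refine HEq.trans ?_ (heq_of_eq (F.map_leftUnitor X).symm)
    simp
  | lam_inv X =>
    refine (congr_arg_heq (fun Z => (λ_ Z).inv) (obj X)).trans ?_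
    refine HEq.trans ?_ (heq_of_eq (F.map_leftUnitor_inv X).symm)
    simp
  | rho_hom X =>
    refine (congr_arg_heq (fun Z => (ρ_ Z).hom) (obj X)).trans ?_
    refine HEq.trans ?_ (heq_of_eq (F.map_rightUnitor X).symm)
    simp
  | rho_inv X =>
    refine (congr_arg_heq (fun Z => (ρ_ Z).inv) (obj X)).trans ?_
    refine HEq.trans ?_ (heq_of_eq (F.map_rightUnitor_inv X).symm)
    simp
  -- On parallel generators, `restrict F` is the value of `F` composed with one transport, placed at
  -- the codomain for the first component and at the domain for the second. The generators covered
  -- by the last case carry no transport, because no tensor or unit occurs in their types.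
  | par₀ a => exact comp_eqToHom_heq _ _
  | par₁ a => exact eqToHom_comp_heq _ _
  | parUnit₀ a => exact comp_eqToHom_heq _ _
  | parUnit₁ a => exact eqToHom_comp_heq _ _
  | _ => rfl

theorem contourLift_restrict (F : StrictMonoidalFunctor (contour B) C) :
    contourLift (restrict F) = F := by
  -- All fields other than the underlying functor are propositions, so equality of functors is
  -- enough; after a representative is chosen, it is the preceding comparison on formal morphisms.
  apply StrictMonoidalFunctor.ext
  refine Functor.hext (liftObj_restrict F) ?_
  rintro X Y ⟨f⟩
  exact liftHom_restrict F f

variable (B C) in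
/-- Strict monoidal functors out of the contour correspond to produoidal functors into the
splice. -/
def contourEquiv : (contourFunctor.obj B ⟶ C) ≃ (B ⟶ spliceFunctor.obj C) where
  toFun F := restrict F
  invFun G := contourLift G
  left_inv := contourLift_restrict
  right_inv := restrict_contourLift

end Lift

/-! ### Naturality of the correspondence and the adjunction. -/

/-- The inclusion of generators as a morphism of produoidal categories. -/
def contourUnitHom (B : PDuo.{u}) : B ⟶ spliceFunctor.obj (contourFunctor.obj B) :=
  contourUnit B

/-- Both sides send an element `t` to the generators attached to its image under `F`. The left side
also carries the transports inserted by `spliceMap`, but `Contour.map F` preserves tensor and unit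
by definition, so they are identities. -/
theorem contourUnitHom_naturality {B B' : PDuo.{u}} (F : B ⟶ B') :
    contourUnitHom B ≫ spliceFunctor.map (contourFunctor.map F) = F ≫ contourUnitHom B' := by
  refine PDuoFunctor.ext rfl (heq_of_eq ?_) (heq_of_eq ?_) (heq_of_eq ?_) (heq_of_eq ?_)
  · funext A X Y t
    exact ParSplit.ext (Category.comp_id _) (Category.id_comp _)
  · funext A i
    exact ParUnit.ext (Category.comp_id _) (Category.id_comp _)
  · rfl
  · rfl

/-- In this form, with the unit followed by the image of `F`, naturality in both variables becomes a
formal computation with `≫`. -/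
theorem contourEquiv_apply {B : PDuo.{u}} {C : MonoCat.{u}} (F : contourFunctor.obj B ⟶ C) :
    contourEquiv B C F = contourUnitHom B ≫ spliceFunctor.map F := rfl

/-- The contour is left adjoint to the splice. -/
def contourSpliceAdjunction : contourFunctor.{u} ⊣ spliceFunctor.{u} :=
  Adjunction.mkOfHomEquiv
    { homEquiv := contourEquiv
      -- Naturality in `B` is required of the inverse transposition. Applying the equivalence to
      -- both sides removes the inverse and leaves naturality of the unit.
      homEquiv_naturality_left_symm := fun f g => by
        rw [Equiv.symm_apply_eq, contourEquiv_apply, Functor.map_comp, ← Category.assoc,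
          contourUnitHom_naturality, Category.assoc, ← contourEquiv_apply,
          Equiv.apply_symm_apply]
      -- Naturality in `C` is functoriality of the splice and associativity of composition.
      homEquiv_naturality_right := fun f g => by
        rw [contourEquiv_apply, contourEquiv_apply, Functor.map_comp, Category.assoc] }

end Produo

theorem mainTheorem7 : Nonempty (Produo.contourFunctor.{u} ⊣ Produo.spliceFunctor.{u}) :=
  ⟨Produo.contourSpliceAdjunction⟩
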